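/- Let $\mathcal{E}$ be a skeletally small, idempotent complete additive category. All subcategories are full and closed under isomorphisms. A right $\mathcal{E}$-module is an additive functor $\mathcal{E}^{\mathrm{op}}\to\mathcal{A}b$; these form the abelian category $\operatorname{Mod}\mathcal{E}$, and $P_X=\mathcal{E}(-,X)$. Let $\operatorname{mod}\mathcal{E}$ be the subcategory of finitely generated modules, i.e. quotients of modules $P_X$ with $X\in\mathcal{E}$; it is an exact category whose conflations are the short exact sequences of $\operatorname{Mod}\mathcal{E}$ with all terms in $\operatorname{mod}\mathcal{E}$. For a module $M$ let $\operatorname{Ext}^i_{\mathcal{E}}(M,\mathcal{E})$ be the $\mathcal{E}^{\mathrm{op}}$-module $X\mapsto \operatorname{Ext}^i_{\operatorname{Mod}\mathcal{E}}(M,P_X)$. Let $\mathcal{C}_2(\mathcal{E})$ be the subcategory of those $M\in\operatorname{Mod}\mathcal{E}$ for which there is an exact sequence $0\to P_X\to P_Y\to P_Z\to M\to 0$ with $X,Y,Z\in\mathcal{E}$ and for which $\operatorname{Ext}^i_{\mathcal{E}}(M,\mathcal{E})=0$ for $i=0,1$. A Serre subcategory of an exact category is an additive subcategory $\mathcal{D}$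 such that for every conflation $L\rightarrowtail M\twoheadrightarrow N$ one has $M\in\mathcal{D}$ if and only if $L,N\in\mathcal{D}$. An exact structure on $\mathcal{E}$ is a class $F$ of kernel-cokernel pairs $X\xrightarrow{f}Y\xrightarrow{g}Z$ in $\mathcal{E}$, closed under isomorphisms, that satisfies the following axioms and their duals: $0\to X= X$ belongs to $F$ for every $X$; the morphisms $g$ occurring in members of $F$ are closed under composition; the pullback of such a $g$ along an arbitrary morphism exists and is again such a morphism. For a class $F$ of kernel-cokernel pairs in $\mathcal{E}$, let $\mathcal{D}(F)$ be the subcategory of all $M\in\operatorname{Mod}\mathcal{E}$ with $M\cong\operatorname{Coker}(P_g)$ for some $X\xrightarrow{f}Y\xrightarrow{g}Z$ in $F$. For a subcategory $\mathcal{D}$ of $\mathcal{C}_2(\mathcal{E})$, let $F(\mathcal{D})$ be the class of all complexes $X\xrightarrow{f}Y\xrightarrow{g}Z$ in $\mathcal{E}$ for which there is an exact sequence $0\to P_X\xrightarrow{P_f}P_Y\xrightarrow{P_g}P_Z\to M\to0$ with $M\in\mathcal{D}$. Then $F\mapsto\mathcal{D}(F)$ and $\mathcal{D}\mapsto F(\mathcal{D})$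 are mutually inverse bijections between 1. exact structures $F$ on $\mathcal{E}$, and 2. subcategories $\mathcal{D}$ of $\mathcal{C}_2(\mathcal{E})$ such that $\mathcal{D}$ is a Serre subcategory of $\operatorname{mod}\mathcal{E}$ and the essential image $\operatorname{Ext}^2_{\mathcal{E}}(\mathcal{D},\mathcal{E})$ of $\mathcal{D}$ under $\operatorname{Ext}^2_{\mathcal{E}}(-,\mathcal{E})$ is a Serre subcategory of $\operatorname{mod}\mathcal{E}^{\mathrm{op}}$. -/

import Mathlib

universe v u

open CategoryTheory Limits Opposite ZeroObject

noncomputable section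

namespace ExactStructures

/-! ### The category of modules over a preadditive category -/

section Modules

variable (C : Type u) [Category.{v} C] [Preadditive C]

/-- `Mod E`: right `E`-modules, i.e. contravariant additive functors from `E` to abelian groups,
with natural transformations as morphisms. Left `E`-modules are the objects of `Modules Eᵒᵖ`. -/
abbrev Modules := Cᵒᵖ ⥤+ AddCommGrpCat.{v}

/-! Additive functors form an abelian subcategory of the category of all functors. -/

instance : (additiveFunctor Cᵒᵖ AddCommGrpCat.{v}).IsClosedUnderSubobjects where
  prop_of_mono {M N} f _ hN := by
    have hN' : N.Additive := hN
    refine (additiveFunctor_iff M).2 ⟨fun {X Y a b} => ?_⟩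
    rw [← cancel_mono (f.app Y)]
    simp [Preadditive.add_comp, Preadditive.comp_add, hN'.map_add]

instance : (additiveFunctor Cᵒᵖ AddCommGrpCat.{v}).IsClosedUnderQuotients where
  prop_of_epi {M N} f _ hM := by
    have hM' : M.Additive := hM
    refine (additiveFunctor_iff N).2 ⟨fun {X Y a b} => ?_⟩
    rw [← cancel_epi (f.app X)]
    simp only [Preadditive.comp_add, ← f.naturality, hM'.map_add, Preadditive.add_comp]

instance : (additiveFunctor Cᵒᵖ AddCommGrpCat.{v}).ContainsZero where
  exists_zero := ⟨(Functor.const _).obj 0,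
    Functor.isZero _ (fun _ => isZero_zero _),
    (additiveFunctor_iff _).2 ⟨fun {_ _ _ _} => (isZero_zero _).eq_of_src _ _⟩⟩

instance (J : Type v) : (additiveFunctor Cᵒᵖ AddCommGrpCat.{v}).IsClosedUnderColimitsOfShape
    (Discrete J) where
  colimitsOfShape_le := by
    rintro M ⟨p⟩
    refine (additiveFunctor_iff M).2 ⟨fun {X Y a b} => ?_⟩
    have hc := isColimitOfPreserves ((evaluation _ _).obj X) p.isColimit
    refine hc.hom_ext fun j => ?_
    have : (p.diag.obj j).Additive := p.prop_diag_obj j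
    have nat : ∀ c : X ⟶ Y, (p.ι.app j).app X ≫ M.map c =
      (p.diag.obj j).map c ≫ (p.ι.app j).app Y := fun c => ((p.ι.app j).naturality c).symm
    change (p.ι.app j).app X ≫ M.map (a + b) = (p.ι.app j).app X ≫ (M.map a + M.map b)
    simp only [Preadditive.comp_add, nat, Functor.map_add, Preadditive.add_comp]

instance (J : Type) : (additiveFunctor Cᵒᵖ AddCommGrpCat.{v}).IsClosedUnderLimitsOfShape
    (Discrete J) where
  limitsOfShape_le := by
    rintro M ⟨p⟩
    refine (additiveFunctor_iff M).2 ⟨fun {X Y a b} => ?_⟩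
    have hc := isLimitOfPreserves ((evaluation _ _).obj Y) p.isLimit
    refine hc.hom_ext fun j => ?_
    have : (p.diag.obj j).Additive := p.prop_diag_obj j
    have nat : ∀ c : X ⟶ Y, M.map c ≫ (p.π.app j).app Y =
      (p.π.app j).app X ≫ (p.diag.obj j).map c := fun c => (p.π.app j).naturality c
    change M.map (a + b) ≫ (p.π.app j).app Y = (M.map a + M.map b) ≫ (p.π.app j).app Y
    simp only [Preadditive.add_comp, nat, Functor.map_add, Preadditive.comp_add]

instance : (additiveFunctor Cᵒᵖ AddCommGrpCat.{v}).IsClosedUnderFiniteProducts where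

/-- `Mod E` is an abelian category. -/
instance : Abelian (Modules C) := inferInstance

instance (J : Type v) : HasColimitsOfShape (Discrete J) (Modules C) := inferInstance

variable {C}

lemma epi_of_surjective {M N : Modules C} (f : M ⟶ N)
    (hf : ∀ X, Function.Surjective (f.hom.app X)) : Epi f := by
  have : ∀ X, Epi (f.hom.app X) := fun X => (AddCommGrpCat.epi_iff_surjective _).2 (hf X)
  have : Epi ((AdditiveFunctor.forget _ _).map f) := NatTrans.epi_of_epi_app f.hom
  exact (AdditiveFunctor.forget Cᵒᵖ AddCommGrpCat.{v}).epi_of_epi_map this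

lemma surjective_of_epi {M N : Modules C} (f : M ⟶ N) [Epi f] (X : Cᵒᵖ) :
    Function.Surjective (f.hom.app X) := by
  have := (additiveFunctor Cᵒᵖ AddCommGrpCat.{v}).preservesEpimorphisms_ι_of_isNormalMonoCategory
  have : Epi f.hom :=
    inferInstanceAs (Epi ((additiveFunctor Cᵒᵖ AddCommGrpCat.{v}).ι.map f))
  rw [← AddCommGrpCat.epi_iff_surjective]
  infer_instance

variable (C) in
/-- The Yoneda embedding `E ⥤ Mod E`, `X ↦ P_X = E(-, X)`. -/
def P : C ⥤ Modules C where
  obj X := AdditiveFunctor.of (preadditiveYoneda.obj X)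
  map f := ObjectProperty.homMk (preadditiveYoneda.map f)

lemma map_op_add {X Y : C} (M : Modules C) (x : M.obj.obj (op X)) (f g : Y ⟶ X) :
    M.obj.map (f + g).op x = M.obj.map f.op x + M.obj.map g.op x := by
  rw [op_add, M.obj.map_add]; rfl

instance : (P C).Additive where
  map_add {X Y f g} := by
    refine ObjectProperty.hom_ext _ (NatTrans.ext (funext fun Z => ?_))
    ext (a : Z.unop ⟶ X)
    exact Preadditive.comp_add _ _ _ a f g

/-- The morphism `P_X ⟶ M` that corresponds to an element of `M(X)`. -/
def ofElement {X : C} {M : Modules C} (x : M.obj.obj (op X)) : (P C).obj X ⟶ M :=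
  ObjectProperty.homMk
    { app := fun Y => AddCommGrpCat.ofHom (AddMonoidHom.mk'
        (fun f : Y.unop ⟶ X => M.obj.map f.op x)
        (fun f g => map_op_add M x f g))
      naturality := fun Y Z h => by
        ext (f : Y.unop ⟶ X)
        change M.obj.map (h.unop ≫ f).op x = M.obj.map h (M.obj.map f.op x)
        rw [op_comp, M.obj.map_comp]; rfl }

lemma ofElement_app_id {X : C} {M : Modules C} (x : M.obj.obj (op X)) :
    (ofElement x).hom.app (op X) (𝟙 X : X ⟶ X) = x := by
  change M.obj.map (𝟙 X : X ⟶ X).op x = x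
  rw [op_id, M.obj.map_id]; rfl

lemma hom_ext_of_app_id {X : C} {M : Modules C} (f g : (P C).obj X ⟶ M)
    (h : f.hom.app (op X) (𝟙 X : X ⟶ X) = g.hom.app (op X) (𝟙 X : X ⟶ X)) : f = g := by
  have key : ∀ (k : (P C).obj X ⟶ M) (Y : Cᵒᵖ) (a : Y.unop ⟶ X),
      k.hom.app Y a = M.obj.map a.op (k.hom.app (op X) (𝟙 X : X ⟶ X)) := by
    intro k Y a
    have := ConcreteCategory.congr_hom (k.hom.naturality a.op) (𝟙 X : X ⟶ X)
    refine Eq.trans ?_ this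
    change k.hom.app Y a = k.hom.app Y (a ≫ 𝟙 X)
    rw [Category.comp_id]
  refine ObjectProperty.hom_ext _ (NatTrans.ext (funext fun Y => ?_))
  ext (a : Y.unop ⟶ X)
  exact (key f Y a).trans ((congrArg _ h).trans (key g Y a).symm)

instance (X : C) : Projective ((P C).obj X) where
  factors {M N} f e _ := by
    obtain ⟨x, hx⟩ := surjective_of_epi e (op X) (f.hom.app (op X) (𝟙 X : X ⟶ X))
    refine ⟨ofElement x, hom_ext_of_app_id _ _ ?_⟩
    change e.hom.app (op X) ((ofElement x).hom.app (op X) (𝟙 X : X ⟶ X)) = _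
    rw [ofElement_app_id, hx]

instance [EssentiallySmall.{v} C] : EnoughProjectives (Modules C) where
  presentation M := by
    let ι : Type v := Σ X : SmallModel.{v} C,
      M.obj.obj (op ((equivSmallModel.{v} C).inverse.obj X))
    let G (i : ι) : Modules C := (P C).obj ((equivSmallModel.{v} C).inverse.obj i.1)
    have hc : HasCoproduct G := HasColimitsOfShape.has_colimit _
    have hG : ∀ i, Projective (G i) := fun i => inferInstanceAs (Projective ((P C).obj _))
    have hp : Projective (∐ G) :=
      ⟨fun f e _ => ⟨Sigma.desc fun i => Projective.factorThru (Sigma.ι G i ≫ f) e, by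
        refine Sigma.hom_ext _ _ fun i => ?_
        rw [Sigma.ι_desc_assoc, Projective.factorThru_comp]⟩⟩
    let p (i : ι) : G i ⟶ M := ofElement i.2
    have he : Epi (Sigma.desc p) := by
      refine epi_of_surjective _ fun Y y => ?_
      let e := (equivSmallModel.{v} C).unitIso.app Y.unop
      let i : ι := ⟨(equivSmallModel.{v} C).functor.obj Y.unop, M.obj.map e.inv.op y⟩
      refine ⟨(Sigma.ι G i).hom.app Y e.hom, ?_⟩
      have h : (Sigma.ι G i ≫ Sigma.desc p) = p i := Sigma.ι_desc _ _
      have h' : (p i).hom.app Y e.hom = y := by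
        change M.obj.map e.hom.op (M.obj.map e.inv.op y) = y
        rw [← ConcreteCategory.comp_apply, ← M.obj.map_comp, ← op_comp, e.hom_inv_id, op_id,
          M.obj.map_id]; rfl
      rw [← h] at h'
      exact h'
    exact ⟨{ p := ∐ G, projective := hp, f := Sigma.desc p, epi := he }⟩

instance [EssentiallySmall.{v} C] : LocallySmall.{v} (Modules C) where
  hom_small M N := by
    let F : SmallModel.{v} C → C := (equivSmallModel.{v} C).inverse.obj
    refine small_of_injective (β := ∀ X : SmallModel.{v} C,
      M.obj.obj (op (F X)) ⟶ N.obj.obj (op (F X))) (f := fun f X => f.hom.app (op (F X))) ?_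
    intro f g hfg
    refine ObjectProperty.hom_ext _ (NatTrans.ext (funext fun Y => ?_))
    let e := (equivSmallModel.{v} C).unitIso.app Y.unop
    have h := congrFun hfg ((equivSmallModel.{v} C).functor.obj Y.unop)
    have : IsIso (M.obj.map e.hom.op) := by
      have : IsIso e.hom.op := isIso_op _
      exact Functor.map_isIso _ _
    refine (cancel_epi (M.obj.map e.hom.op)).1 ?_
    exact (f.hom.naturality e.hom.op).trans
      ((congrArg (· ≫ N.obj.map e.hom.op) h).trans (g.hom.naturality e.hom.op).symm)

instance [EssentiallySmall.{v} C] : HasExt.{v} (Modules C) :=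
  hasExt_of_enoughProjectives.{v} (Modules C)

end Modules

/-! ### Modules: finite generation, the functors `Ext^i(-, E)`, Serre subcategories -/

section

variable {C : Type u} [Category.{v} C] [Preadditive C]

variable (C) in
/-- `mod E`: the finitely generated `E`-modules. -/
def finGen : ObjectProperty (Modules C) :=
  fun M => ∃ (X : C) (p : (P C).obj X ⟶ M), Epi p

/-- The left `E`-module `Ext^i_E(M, E)`, i.e. the functor `X ↦ Ext^i(M, P_X)`, as a right module
over `Eᵒᵖ`. -/
def extModule [EssentiallySmall.{v} C] (M : Modules C) (i : ℕ) : Modules Cᵒᵖ :=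
  haveI : (unopUnop C).Additive := ⟨rfl⟩
  AdditiveFunctor.of (unopUnop C ⋙ P C ⋙ Abelian.extFunctorObj M i)

/-- `D` is a Serre subcategory of the exact category `mod E`, the conflations of `mod E` being the
short exact sequences of `Mod E` with all terms in `mod E`. Closure of `D` under finite direct
sums, which is part of being an additive subcategory, follows from `zero` and `iff_of_shortExact`.
-/
structure IsSerreInFinGen (D : ObjectProperty (Modules C)) : Prop where
  le : D ≤ finGen C
  closedUnderIso : D.IsClosedUnderIsomorphisms
  zero : D.ContainsZero
  iff_of_shortExact : ∀ S : ShortComplex (Modules C), S.ShortExact →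
    finGen C S.X₁ → finGen C S.X₂ → finGen C S.X₃ → (D S.X₂ ↔ D S.X₁ ∧ D S.X₃)

/-- The sequence `0 ⟶ P_X ⟶ P_Y ⟶ P_Z ⟶ M ⟶ 0` with the given morphisms is exact. -/
structure IsRes {X Y Z : C} {M : Modules C} (a : (P C).obj X ⟶ (P C).obj Y)
    (b : (P C).obj Y ⟶ (P C).obj Z) (p : (P C).obj Z ⟶ M) : Prop where
  mono : Mono a
  exact₁ : ∃ w : a ≫ b = 0, (ShortComplex.mk a b w).Exact
  exact₂ : ∃ w : b ≫ p = 0, (ShortComplex.mk b p w).Exact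
  epi : Epi p

variable (C) in
/-- `C₂(E)`: the modules `M` such that there is an exact sequence
`0 ⟶ P_X ⟶ P_Y ⟶ P_Z ⟶ M ⟶ 0` and `Ext^i_E(M, E) = 0` for `i = 0, 1`. -/
def C₂ [EssentiallySmall.{v} C] : ObjectProperty (Modules C) :=
  fun M => (∃ (X Y Z : C) (a : (P C).obj X ⟶ (P C).obj Y) (b : (P C).obj Y ⟶ (P C).obj Z)
      (p : (P C).obj Z ⟶ M), IsRes a b p) ∧
    IsZero (extModule M 0) ∧ IsZero (extModule M 1)

/-- `Ext²_E(D, E)`: the essential image of `D` under `Ext²_E(-, E)`. -/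
def ext₂Image [EssentiallySmall.{v} C] (D : ObjectProperty (Modules C)) :
    ObjectProperty (Modules Cᵒᵖ) :=
  fun N => ∃ M, D M ∧ Nonempty (N ≅ extModule M 2)

/-- The subcategories `D` of `C₂(E)` such that `D` is a Serre subcategory of `mod E` and
`Ext²_E(D, E)` is a Serre subcategory of `mod Eᵒᵖ`. -/
structure IsTwoRegular [EssentiallySmall.{v} C] (D : ObjectProperty (Modules C)) : Prop where
  le : D ≤ C₂ C
  serre : IsSerreInFinGen D
  serre_ext₂ : IsSerreInFinGen (ext₂Image D)

end

/-! ### Exact structures -/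

section

variable {C : Type u} [Category.{v} C] [Preadditive C]

/-- `X ⟶ Y ⟶ Z` is a kernel-cokernel pair. -/
def IsKernelCokernelPair (S : ShortComplex C) : Prop :=
  Nonempty (IsLimit (KernelFork.ofι S.f S.zero)) ∧
    Nonempty (IsColimit (CokernelCofork.ofπ S.g S.zero))

/-- `f` is an `F`-monomorphism (an inflation, if `F` is an exact structure). -/
def IsInflation (F : ObjectProperty (ShortComplex C)) {X Y : C} (f : X ⟶ Y) : Prop :=
  ∃ (Z : C) (g : Y ⟶ Z) (w : f ≫ g = 0), F (ShortComplex.mk f g w)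

/-- `g` is an `F`-epimorphism (a deflation, if `F` is an exact structure). -/
def IsDeflation (F : ObjectProperty (ShortComplex C)) {Y Z : C} (g : Y ⟶ Z) : Prop :=
  ∃ (X : C) (f : X ⟶ Y) (w : f ≫ g = 0), F (ShortComplex.mk f g w)

/-- The class `F` of complexes `X ⟶ Y ⟶ Z` is an exact structure on `E` (Quillen's axioms). -/
structure IsExactStructure [HasZeroObject C] (F : ObjectProperty (ShortComplex C)) : Prop where
  kernelCokernel : ∀ S, F S → IsKernelCokernelPair S
  closedUnderIso : F.IsClosedUnderIsomorphisms
  ex₀ : ∀ X : C, F (ShortComplex.mk (0 : (0 : C) ⟶ X) (𝟙 X) zero_comp)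
  ex₀_op : ∀ X : C, F (ShortComplex.mk (𝟙 X) (0 : X ⟶ (0 : C)) comp_zero)
  ex₁ : ∀ {X Y Z : C} (f : X ⟶ Y) (g : Y ⟶ Z),
    IsDeflation F f → IsDeflation F g → IsDeflation F (f ≫ g)
  ex₁_op : ∀ {X Y Z : C} (f : X ⟶ Y) (g : Y ⟶ Z),
    IsInflation F f → IsInflation F g → IsInflation F (f ≫ g)
  ex₂ : ∀ {Y Z W : C} (g : Y ⟶ Z) (h : W ⟶ Z), IsDeflation F g →
    ∃ (A : C) (l : A ⟶ Y) (k : A ⟶ W), IsPullback l k g h ∧ IsDeflation F k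
  ex₂_op : ∀ {X Y W : C} (f : X ⟶ Y) (h : X ⟶ W), IsInflation F f →
    ∃ (A : C) (l : Y ⟶ A) (k : W ⟶ A), IsPushout f h l k ∧ IsInflation F k

/-- `D(F)`: the modules isomorphic to `Coker(P_g)` for some `F`-exact complex `X ⟶ Y ⟶ Z` with
second morphism `g` (the contravariant defects of `F`). -/
def defects (F : ObjectProperty (ShortComplex C)) : ObjectProperty (Modules C) :=
  fun M => ∃ S : ShortComplex C, F S ∧ Nonempty (M ≅ cokernel ((P C).map S.g))

/-- `F(D)`: the complexes `X ⟶ Y ⟶ Z` for which there is an exact sequence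
`0 ⟶ P_X ⟶ P_Y ⟶ P_Z ⟶ M ⟶ 0` with `M` in `D`, where `P_X ⟶ P_Y ⟶ P_Z` is induced by the given
complex. -/
def conflationsOf (D : ObjectProperty (Modules C)) : ObjectProperty (ShortComplex C) :=
  fun S => ∃ (M : Modules C) (p : (P C).obj S.X₃ ⟶ M),
    IsRes ((P C).map S.f) ((P C).map S.g) p ∧ D M

end

end ExactStructures

end

/-! Morphisms `P_T ⟶ M` serve as elements of `M`, so a presentation of a module is a morphism `g` of
the category `E`, and statements about modules become lifting problems in `E`.

The Serre condition on modules mirrors the closure axioms on deflations. If `g` presents `M`, a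
submodule with generators `h` is presented by the pullback of `g` along `h`, the quotient by the
matrix `(g h)`, and an extension by a triangular matrix. Both matrices are composites of pullbacks
of deflations, hence deflations (`IsDeflationClass.isSerreInFinGen`). Conversely, the image and
cokernel of `P_W ⟶ Coker P_g` yield pullbacks (`isDeflation_pullback`), and the maps between the
cokernels of `g₁`, `g₁ ≫ g₂` and `g₂` yield composition (`isDeflation_comp`). The kernels needed
here come from a Schanuel argument that splits an idempotent (`IsPresentation.exists_isKer`).

The axioms on inflations follow by duality. If `X ⟶ Y ⟶ Z` resolves `M`, the vanishing of `Ext⁰` and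
`Ext¹` says that the second morphism is a cokernel of the first, and then the opposite complex
resolves `Ext²(M, E)`. Hence `Ext²(D, E)` plays over `Eᵒᵖ` the role of `D`
(`isInflation_conflationsOf_iff`).

That `D(F(D)) = D` holds because a presentation determines its module. That `F(D(F)) = F` requires
membership in `F` to depend only on the cokernel module: `IsExactStructure.conflationsOf_defects`
adds a summand to obtain a deflation, then removes it by a pushout. -/

namespace ExactStructures

/-! ### Yoneda: morphisms from representable modules as elements -/

section Elements

variable {C : Type u} [Category.{v} C] [Preadditive C]

instance : (P C).Full where
  map_surjective {X Y} φ := by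
    refine ⟨(φ.hom.app (op X) (𝟙 X : X ⟶ X) : X ⟶ Y), hom_ext_of_app_id _ _ ?_⟩
    exact Category.id_comp _

instance : (P C).Faithful where
  map_injective {X Y} f g h := by
    have := congrArg (fun φ : (P C).obj X ⟶ (P C).obj Y => φ.hom.app (op X) (𝟙 X : X ⟶ X)) h
    exact (Category.id_comp f).symm.trans (this.trans (Category.id_comp g))

lemma P_map_eq_zero_iff {X Y : C} (f : X ⟶ Y) : (P C).map f = 0 ↔ f = 0 :=
  (P C).map_eq_zero_iff

lemma ofElement_bijective {X : C} {M : Modules C} :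
    Function.Bijective (ofElement (X := X) (M := M)) := by
  refine ⟨fun x y h => ?_, fun f => ⟨f.hom.app (op X) (𝟙 X : X ⟶ X),
    hom_ext_of_app_id _ _ (ofElement_app_id _)⟩⟩
  rw [← ofElement_app_id x, h, ofElement_app_id]

lemma ofElement_comp {X : C} {M N : Modules C} (x : M.obj.obj (op X)) (f : M ⟶ N) :
    ofElement x ≫ f = ofElement (f.hom.app (op X) x) := by
  refine hom_ext_of_app_id _ _ ?_
  rw [ofElement_app_id]
  exact congrArg (f.hom.app (op X)) (ofElement_app_id x)

lemma epi_of_lift {M N : Modules C} (f : M ⟶ N)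
    (h : ∀ (T : C) (y : (P C).obj T ⟶ N), ∃ x, x ≫ f = y) : Epi f := by
  refine epi_of_surjective f fun ⟨T⟩ y => ?_
  obtain ⟨x, hx⟩ := h T (ofElement y)
  obtain ⟨x, rfl⟩ := ofElement_bijective.2 x
  rw [ofElement_comp] at hx
  exact ⟨x, ofElement_bijective.1 hx⟩

lemma exists_lift {M N : Modules C} (f : M ⟶ N) [Epi f] {T : C} (y : (P C).obj T ⟶ N) :
    ∃ x, x ≫ f = y :=
  ⟨Projective.factorThru y f, Projective.factorThru_comp y f⟩

lemma exists_map_lift {Z T : C} {N : Modules C} (f : (P C).obj Z ⟶ N) [Epi f]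
    (y : (P C).obj T ⟶ N) : ∃ x : T ⟶ Z, (P C).map x ≫ f = y := by
  obtain ⟨x, hx⟩ := exists_lift f y
  obtain ⟨x, rfl⟩ := (P C).map_surjective x
  exact ⟨x, hx⟩

lemma eq_of_precomp_eq {M N : Modules C} (f g : M ⟶ N)
    (h : ∀ (T : C) (x : (P C).obj T ⟶ M), x ≫ f = x ≫ g) : f = g := by
  refine ObjectProperty.hom_ext _ (NatTrans.ext (funext fun ⟨T⟩ => ?_))
  ext x
  have := h T (ofElement x)
  rw [ofElement_comp, ofElement_comp] at this
  exact ofElement_bijective.1 this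

lemma mono_of_cancel {M N : Modules C} (f : M ⟶ N)
    (h : ∀ (T : C) (x : (P C).obj T ⟶ M), x ≫ f = 0 → x = 0) : Mono f := by
  refine Preadditive.mono_of_cancel_zero f fun {K} g hg => ?_
  refine eq_of_precomp_eq _ _ fun T x => ?_
  rw [comp_zero]
  exact h T _ (by rw [Category.assoc, hg, comp_zero])

lemma exact_lift {S : ShortComplex (Modules C)} (hS : S.Exact) {T : C}
    (x : (P C).obj T ⟶ S.X₂) (hx : x ≫ S.g = 0) : ∃ y, y ≫ S.f = x :=
  ⟨hS.liftFromProjective x hx, hS.liftFromProjective_comp x hx⟩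

lemma exact_of_lift (S : ShortComplex (Modules C))
    (h : ∀ (T : C) (x : (P C).obj T ⟶ S.X₂), x ≫ S.g = 0 → ∃ y, y ≫ S.f = x) : S.Exact := by
  rw [S.exact_iff_epi_kernel_lift]
  refine epi_of_lift _ fun T y => ?_
  obtain ⟨x, hx⟩ := h T (y ≫ kernel.ι S.g) (by simp)
  exact ⟨x, by rw [← cancel_mono (kernel.ι S.g), ← hx]; simp⟩

end Elements

/-! ### Presentations, kernels and cokernels in terms of lifting -/

section Presentations

variable {C : Type u} [Category.{v} C] [Preadditive C]

/-- The sequence `P_Y ⟶ P_Z ⟶ M ⟶ 0` is exact. -/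
structure IsPresentation {Y Z : C} (g : Y ⟶ Z) {M : Modules C} (p : (P C).obj Z ⟶ M) : Prop where
  epi : Epi p
  zero : (P C).map g ≫ p = 0
  lift : ∀ {T : C} (x : T ⟶ Z), (P C).map x ≫ p = 0 → ∃ y, y ≫ g = x

/-- `f` is a kernel of `g`. -/
structure IsKer {X Y Z : C} (f : X ⟶ Y) (g : Y ⟶ Z) : Prop where
  mono : Mono f
  zero : f ≫ g = 0
  lift : ∀ {T : C} (x : T ⟶ Y), x ≫ g = 0 → ∃ y, y ≫ f = x

/-- `g` is a cokernel of `f`. -/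
structure IsCoker {X Y Z : C} (f : X ⟶ Y) (g : Y ⟶ Z) : Prop where
  epi : Epi g
  zero : f ≫ g = 0
  desc : ∀ {T : C} (x : Y ⟶ T), f ≫ x = 0 → ∃ y, g ≫ y = x

lemma IsKer.op {X Y Z : C} {f : X ⟶ Y} {g : Y ⟶ Z} (h : IsKer f g) : IsCoker g.op f.op where
  epi := have := h.mono; inferInstance
  zero := by rw [← op_comp, h.zero, op_zero]
  desc x hx := by
    obtain ⟨y, hy⟩ := h.lift x.unop (Quiver.Hom.op_inj hx)
    exact ⟨y.op, Quiver.Hom.unop_inj hy⟩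

lemma IsCoker.op {X Y Z : C} {f : X ⟶ Y} {g : Y ⟶ Z} (h : IsCoker f g) : IsKer g.op f.op where
  mono := have := h.epi; inferInstance
  zero := by rw [← op_comp, h.zero, op_zero]
  lift x hx := by
    obtain ⟨y, hy⟩ := h.desc x.unop (Quiver.Hom.op_inj hx)
    exact ⟨y.op, Quiver.Hom.unop_inj hy⟩

lemma IsCoker.unop {X Y Z : Cᵒᵖ} {f : X ⟶ Y} {g : Y ⟶ Z} (h : IsCoker f g) :
    IsKer g.unop f.unop where
  mono := have := h.epi; inferInstance
  zero := by rw [← unop_comp, h.zero, unop_zero]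
  lift x hx := by
    obtain ⟨y, hy⟩ := h.desc x.op (Quiver.Hom.unop_inj hx)
    exact ⟨y.unop, Quiver.Hom.op_inj hy⟩

lemma isKernelCokernelPair_iff (S : ShortComplex C) :
    IsKernelCokernelPair S ↔ IsKer S.f S.g ∧ IsCoker S.f S.g := by
  constructor
  · rintro ⟨⟨hk⟩, ⟨hc⟩⟩
    refine ⟨⟨mono_of_isLimit_fork hk, S.zero, fun x hx => ?_⟩,
      ⟨epi_of_isColimit_cofork hc, S.zero, fun x hx => ?_⟩⟩
    · exact ⟨(KernelFork.IsLimit.lift' hk x hx).1, (KernelFork.IsLimit.lift' hk x hx).2⟩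
    · exact ⟨(CokernelCofork.IsColimit.desc' hc x hx).1, (CokernelCofork.IsColimit.desc' hc x hx).2⟩
  · rintro ⟨hk, hc⟩
    have := hk.mono
    have := hc.epi
    exact ⟨⟨KernelFork.IsLimit.ofι' _ _ fun x hx => ⟨_, (hk.lift x hx).choose_spec⟩⟩,
      ⟨CokernelCofork.IsColimit.ofπ' _ _ fun x hx => ⟨_, (hc.desc x hx).choose_spec⟩⟩⟩

lemma IsPresentation.exact {Y Z : C} {g : Y ⟶ Z} {M : Modules C} {p : (P C).obj Z ⟶ M}
    (h : IsPresentation g p) : (ShortComplex.mk _ _ h.zero).Exact := by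
  refine exact_of_lift _ fun T x hx => ?_
  obtain ⟨x, rfl⟩ := (P C).map_surjective x
  obtain ⟨y, rfl⟩ := h.lift x hx
  exact ⟨(P C).map y, ((P C).map_comp _ _).symm⟩

lemma isPresentation_of_exact {Y Z : C} {g : Y ⟶ Z} {M : Modules C} {p : (P C).obj Z ⟶ M}
    [Epi p] (w : (P C).map g ≫ p = 0) (h : (ShortComplex.mk _ _ w).Exact) :
    IsPresentation g p where
  epi := inferInstance
  zero := w
  lift x hx := by
    obtain ⟨y, hy⟩ := exact_lift h ((P C).map x) hx
    obtain ⟨y, rfl⟩ := (P C).map_surjective y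
    exact ⟨y, (P C).map_injective (((P C).map_comp _ _).trans hy)⟩

lemma isPresentation_cokernel {Y Z : C} (g : Y ⟶ Z) :
    IsPresentation g (cokernel.π ((P C).map g)) :=
  isPresentation_of_exact (cokernel.condition _) (ShortComplex.exact_cokernel _)

lemma IsPresentation.desc {Y Z : C} {g : Y ⟶ Z} {M : Modules C} {p : (P C).obj Z ⟶ M}
    (h : IsPresentation g p) {N : Modules C} (q : (P C).obj Z ⟶ N) (hq : (P C).map g ≫ q = 0) :
    ∃ m, p ≫ m = q := by
  have := h.epi
  exact ⟨h.exact.desc q hq, h.exact.g_desc q hq⟩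

/-- A presentation determines the module. -/
lemma IsPresentation.unique {Y Z : C} {g : Y ⟶ Z} {M M' : Modules C}
    {p : (P C).obj Z ⟶ M} {p' : (P C).obj Z ⟶ M'} (h : IsPresentation g p)
    (h' : IsPresentation g p') : Nonempty (M ≅ M') := by
  have := h.epi
  have := h'.epi
  obtain ⟨m, hm⟩ := h.desc p' h'.zero
  obtain ⟨n, hn⟩ := h'.desc p h.zero
  exact ⟨⟨m, n, by rw [← cancel_epi p]; simp [reassoc_of% hm, hn],
    by rw [← cancel_epi p']; simp [reassoc_of% hn, hm]⟩⟩

lemma IsPresentation.of_iso {Y Z : C} {g : Y ⟶ Z} {M M' : Modules C}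
    {p : (P C).obj Z ⟶ M} (h : IsPresentation g p) (e : M ≅ M') : IsPresentation g (p ≫ e.hom) where
  epi := have := h.epi; inferInstance
  zero := by rw [← Category.assoc, h.zero, zero_comp]
  lift x hx := h.lift x (by rw [← cancel_mono e.hom, Category.assoc, hx, zero_comp])

lemma IsPresentation.finGen {Y Z : C} {g : Y ⟶ Z} {M : Modules C} {p : (P C).obj Z ⟶ M}
    (h : IsPresentation g p) : finGen C M := ⟨Z, p, h.epi⟩

lemma finGen_of_epi {M N : Modules C} (f : M ⟶ N) [Epi f] (h : finGen C M) : finGen C N := by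
  obtain ⟨Z, p, hp⟩ := h
  exact ⟨Z, p ≫ f, inferInstance⟩

lemma isRes_map_iff {X Y Z : C} {f : X ⟶ Y} {g : Y ⟶ Z} {M : Modules C} {p : (P C).obj Z ⟶ M} :
    IsRes ((P C).map f) ((P C).map g) p ↔ IsKer f g ∧ IsPresentation g p := by
  constructor
  · rintro ⟨h₁, ⟨w, h₂⟩, ⟨w', h₃⟩, h₄⟩
    refine ⟨⟨(P C).mono_of_mono_map h₁, ?_, fun x hx => ?_⟩, isPresentation_of_exact w' h₃⟩
    · rwa [← P_map_eq_zero_iff, (P C).map_comp]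
    · obtain ⟨y, hy⟩ := exact_lift h₂ ((P C).map x)
        (by change _ ≫ (P C).map g = 0; rw [← (P C).map_comp, hx, (P C).map_zero])
      obtain ⟨y, rfl⟩ := (P C).map_surjective y
      exact ⟨y, (P C).map_injective (((P C).map_comp _ _).trans hy)⟩
  · rintro ⟨hk, hp⟩
    refine ⟨mono_of_cancel _ fun T x hx => ?_,
      ⟨by rw [← (P C).map_comp, hk.zero, (P C).map_zero], exact_of_lift _ fun T x hx => ?_⟩,
      ⟨hp.zero, hp.exact⟩, hp.epi⟩
    · obtain ⟨x, rfl⟩ := (P C).map_surjective x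
      rw [← (P C).map_comp, P_map_eq_zero_iff] at hx
      have := hk.mono
      rw [P_map_eq_zero_iff, ← cancel_mono f, hx, zero_comp]
    · obtain ⟨x, rfl⟩ := (P C).map_surjective x
      change _ ≫ (P C).map g = 0 at hx
      rw [← (P C).map_comp, P_map_eq_zero_iff] at hx
      obtain ⟨y, rfl⟩ := hk.lift x hx
      exact ⟨(P C).map y, ((P C).map_comp _ _).symm⟩

end Presentations

/-! ### Presentations of quotients, submodules and extensions -/

section ShortExact

variable {C : Type u} [Category.{v} C] [Preadditive C]

/-- If `h` represents generators of the submodule `S.X₁` of `S.X₂`, a presentation of `S.X₂`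
induces one of the quotient `S.X₃`. -/
lemma IsPresentation.quotient [HasBinaryBiproducts C] {S : ShortComplex (Modules C)}
    (hS : S.ShortExact) {Y Z W : C} {g : Y ⟶ Z} {p : (P C).obj Z ⟶ S.X₂}
    (hp : IsPresentation g p) {l : (P C).obj W ⟶ S.X₁} [Epi l] {h : W ⟶ Z}
    (hl : (P C).map h ≫ p = l ≫ S.f) : IsPresentation (biprod.desc g h) (p ≫ S.g) where
  epi := by
    have := hp.epi
    have := hS.epi_g
    infer_instance
  zero := by
    have e : biprod.desc g h = biprod.fst ≫ g + biprod.snd ≫ h := biprod.desc_eq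
    rw [e]
    simp [Preadditive.add_comp, reassoc_of% hp.zero, reassoc_of% hl]
  lift {T} x hx := by
    obtain ⟨y, hy⟩ := exact_lift hS.exact ((P C).map x ≫ p) (by rw [Category.assoc, hx])
    obtain ⟨w, rfl⟩ := exists_map_lift l y
    obtain ⟨z, hz⟩ := hp.lift (x - w ≫ h) (by
      rw [(P C).map_sub, Preadditive.sub_comp, (P C).map_comp, Category.assoc, hl,
        ← Category.assoc, hy, sub_self])
    exact ⟨biprod.lift z w, by simp [hz]⟩

/-- The submodule `S.X₁` of `S.X₂` generated by `h` is presented by the pullback along `h`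
of a presentation of `S.X₂`. -/
lemma IsPresentation.sub {S : ShortComplex (Modules C)} (hS : S.ShortExact) {A Y Z W : C}
    {g : Y ⟶ Z} {p : (P C).obj Z ⟶ S.X₂} (hp : IsPresentation g p) {l : (P C).obj W ⟶ S.X₁}
    [Epi l] {h : W ⟶ Z} (hl : (P C).map h ≫ p = l ≫ S.f) {a : A ⟶ Y} {k : A ⟶ W}
    (hk : IsPullback a k g h) : IsPresentation k l where
  epi := inferInstance
  zero := by
    have := hS.mono_f
    rw [← cancel_mono S.f, Category.assoc, ← hl, ← Category.assoc, ← (P C).map_comp, ← hk.w,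
      (P C).map_comp, Category.assoc, hp.zero, comp_zero, zero_comp]
  lift {T} x hx := by
    obtain ⟨y, hy⟩ := hp.lift (x ≫ h) (by
      rw [(P C).map_comp, Category.assoc, hl, ← Category.assoc, hx, zero_comp])
    exact ⟨hk.lift y x hy, hk.lift_snd _ _ _⟩

/-- The horseshoe lemma for presentations. -/
lemma IsPresentation.extension [HasBinaryBiproducts C] {S : ShortComplex (Modules C)}
    (hS : S.ShortExact) {Y Z Y' Z' : C} {g : Y ⟶ Z} {p : (P C).obj Z ⟶ S.X₁}
    (hp : IsPresentation g p) {g' : Y' ⟶ Z'} {p' : (P C).obj Z' ⟶ S.X₃}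
    (hp' : IsPresentation g' p') :
    ∃ (u : Y' ⟶ Z) (q : (P C).obj (Z ⊞ Z') ⟶ S.X₂), IsPresentation
      (biprod.lift (biprod.fst ≫ g + biprod.snd ≫ u) biprod.snd ≫ biprod.map (𝟙 Z) g') q := by
  have := hS.epi_g
  have := hS.mono_f
  have := hp.epi
  have := hp'.epi
  obtain ⟨q, hq⟩ := exists_lift S.g p'
  obtain ⟨r, hr⟩ := exact_lift hS.exact ((P C).map g' ≫ q) (by rw [Category.assoc, hq, hp'.zero])
  -- The sign makes the relation `(u, g')` vanish in `S.X₂`: the image of `u` cancels that of `g'`.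
  obtain ⟨u, hu⟩ := exists_map_lift p (-r)
  replace hr : (P C).map u ≫ p ≫ S.f = - (P C).map g' ≫ q := by
    rw [← Category.assoc, hu, Preadditive.neg_comp, hr]
  have e : biprod.lift (biprod.fst ≫ g + biprod.snd ≫ u) biprod.snd ≫ biprod.map (𝟙 Z) g' =
      biprod.lift (biprod.fst ≫ g + biprod.snd ≫ u) (biprod.snd ≫ g') := by
    ext <;> simp
  have key : ∀ {T : C} (x : T ⟶ Z ⊞ Z'),
      (P C).map x ≫ ((P C).map biprod.fst ≫ p ≫ S.f + (P C).map biprod.snd ≫ q) =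
      (P C).map (x ≫ biprod.fst) ≫ p ≫ S.f + (P C).map (x ≫ biprod.snd) ≫ q := by
    intro T x
    simp
  refine ⟨u, (P C).map biprod.fst ≫ p ≫ S.f + (P C).map biprod.snd ≫ q, ?_, ?_, ?_⟩
  · refine epi_of_lift _ fun T y => ?_
    obtain ⟨z', hz'⟩ := exists_map_lift p' (y ≫ S.g)
    obtain ⟨w, hw⟩ := exact_lift hS.exact (y - (P C).map z' ≫ q) (by
      rw [Preadditive.sub_comp, Category.assoc, hq, hz', sub_self])
    obtain ⟨z, rfl⟩ := exists_map_lift p w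
    refine ⟨(P C).map (biprod.lift z z'), ?_⟩
    rw [key, biprod.lift_fst, biprod.lift_snd, ← Category.assoc ((P C).map z), hw, sub_add_cancel]
  · rw [e, key, biprod.lift_fst, biprod.lift_snd]
    simp [Preadditive.add_comp, hr, reassoc_of% hp.zero]
  · intro T x hx
    rw [key] at hx
    obtain ⟨y', hy'⟩ := hp'.lift (x ≫ biprod.snd) (by
      have := congrArg (· ≫ S.g) hx
      simpa [Preadditive.add_comp, hq] using this)
    obtain ⟨y, hy⟩ := hp.lift (x ≫ biprod.fst - y' ≫ u) (by
      rw [← cancel_mono S.f, zero_comp, ← hx, ← hy', (P C).map_comp y' g', Category.assoc,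
        (P C).map_sub, (P C).map_comp y' u]
      simp only [Preadditive.sub_comp, Category.assoc, hr]
      simp [sub_eq_add_neg])
    refine ⟨biprod.lift y y', ?_⟩
    rw [e]
    ext
    · simp [hy]
    · simp [hy']

end ShortExact

/-! ### From deflations to Serre subcategories -/

section Deflations

variable {C : Type u} [Category.{v} C]

/-- The axioms on the deflations of an exact structure that do not mention kernels. -/
structure IsDeflationClass (Q : MorphismProperty C) : Prop where
  of_isIso : ∀ {X Y : C} (f : X ⟶ Y), IsIso f → Q f
  to_zero : ∀ {X Y : C} (f : X ⟶ Y), IsZero Y → Q f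
  comp : ∀ {X Y Z : C} (f : X ⟶ Y) (g : Y ⟶ Z), Q f → Q g → Q (f ≫ g)
  pullback : ∀ {Y Z W : C} (g : Y ⟶ Z) (h : W ⟶ Z), Q g →
    ∃ (A : C) (l : A ⟶ Y) (k : A ⟶ W), IsPullback l k g h ∧ Q k

namespace IsDeflationClass

variable {Q : MorphismProperty C} (hQ : IsDeflationClass Q)
include hQ

lemma of_isPullback {A Y Z W : C} {l : A ⟶ Y} {k : A ⟶ W} {g : Y ⟶ Z} {h : W ⟶ Z}
    (sq : IsPullback l k g h) (hg : Q g) : Q k := by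
  obtain ⟨A', l', k', sq', hk'⟩ := hQ.pullback g h hg
  rw [← sq.isoIsPullback_hom_snd _ _ sq']
  exact hQ.comp _ _ (hQ.of_isIso _ inferInstance) hk'

variable [Preadditive C] [HasBinaryBiproducts C]

lemma fst [HasZeroObject C] (Z W : C) : Q (biprod.fst : Z ⊞ W ⟶ Z) :=
  hQ.of_isPullback (IsPullback.of_has_biproduct Z W).flip (hQ.to_zero _ (isZero_zero C))

/-- It is the pullback of `g` along `(z, y') ↦ z - u y'`. -/
lemma shear {Y Z Y' : C} {g : Y ⟶ Z} (hg : Q g) (u : Y' ⟶ Z) :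
    Q (biprod.lift (biprod.fst ≫ g + biprod.snd ≫ u) biprod.snd : Y ⊞ Y' ⟶ Z ⊞ Y') := by
  refine hQ.of_isPullback (l := biprod.fst) (h := biprod.desc (𝟙 Z) (-u)) (g := g)
    ?_ hg
  refine ⟨⟨by simp [biprod.lift_desc]⟩, ⟨PullbackCone.IsLimit.mk _
    (fun s => biprod.lift s.fst (s.snd ≫ biprod.snd)) (by simp) ?_ ?_⟩⟩
  · intro s
    have e : s.fst ≫ g = s.snd ≫ biprod.fst - s.snd ≫ biprod.snd ≫ u := by
      refine s.condition.trans ?_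
      simp [biprod.desc_eq, sub_eq_add_neg]
    ext <;> simp [e]
  · intro s m h₁ h₂
    ext
    · simp [h₁]
    · simp [← h₂]

lemma map_id {Z Y' Z' : C} {g' : Y' ⟶ Z'} (hg : Q g') : Q (biprod.map (𝟙 Z) g') := by
  refine hQ.of_isPullback (l := biprod.snd) (h := biprod.snd) (g := g') ?_ hg
  refine ⟨⟨by simp⟩, ⟨PullbackCone.IsLimit.mk _
    (fun s => biprod.lift (s.snd ≫ biprod.fst) s.fst) (by simp) ?_ ?_⟩⟩
  · intro s
    have := s.condition
    ext <;> simp [this]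
  · intro s m h₁ h₂
    ext
    · simp [← h₂]
    · simp [h₁]

/-- A shear followed by a projection, and each of these is a pullback of a deflation. -/
lemma desc [HasZeroObject C] {Y Z W : C} {g : Y ⟶ Z} (hg : Q g) (h : W ⟶ Z) :
    Q (biprod.desc g h) := by
  have e : biprod.desc g h =
      biprod.lift (biprod.fst ≫ g + biprod.snd ≫ h) biprod.snd ≫ biprod.fst := by
    rw [biprod.lift_fst, biprod.desc_eq]
  rw [e]
  exact hQ.comp _ _ (hQ.shear hg h) (hQ.fst _ _)

/-- The modules presented by deflations form a Serre subcategory. -/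
lemma isSerreInFinGen [HasZeroObject C] {D : ObjectProperty (Modules C)}
    (hD : ∀ M, D M ↔ ∃ (Y Z : C) (g : Y ⟶ Z) (p : (P C).obj Z ⟶ M), Q g ∧ IsPresentation g p) :
    IsSerreInFinGen D where
  le M hM := by
    obtain ⟨Y, Z, g, p, -, hp⟩ := (hD M).1 hM
    exact hp.finGen
  closedUnderIso := ⟨fun {M N} e hM => by
    obtain ⟨Y, Z, g, p, hg, hp⟩ := (hD M).1 hM
    exact (hD N).2 ⟨Y, Z, g, _, hg, hp.of_iso e⟩⟩
  zero := ⟨cokernel ((P C).map (𝟙 (0 : C))), isZero_cokernel_of_epi _,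
    (hD _).2 ⟨_, _, _, _, hQ.of_isIso _ inferInstance, isPresentation_cokernel _⟩⟩
  iff_of_shortExact S hS h₁ h₂ h₃ := by
    constructor
    · intro hM
      obtain ⟨Y, Z, g, p, hg, hp⟩ := (hD _).1 hM
      obtain ⟨W, l, hl⟩ := h₁
      have := hp.epi
      obtain ⟨h, hh⟩ := exists_map_lift p (l ≫ S.f)
      obtain ⟨A, a, k, sq, hk⟩ := hQ.pullback g h hg
      exact ⟨(hD _).2 ⟨_, _, k, l, hk, hp.sub hS hh sq⟩,
        (hD _).2 ⟨_, _, _, _, hQ.desc hg h, hp.quotient hS hh⟩⟩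
    · rintro ⟨hL, hN⟩
      obtain ⟨Y, Z, g, p, hg, hp⟩ := (hD _).1 hL
      obtain ⟨Y', Z', g', p', hg', hp'⟩ := (hD _).1 hN
      obtain ⟨u, q, hq⟩ := IsPresentation.extension hS hp hp'
      exact (hD _).2 ⟨_, _, _, q, hQ.comp _ _ (hQ.shear hg u) (hQ.map_id hg'), hq⟩

end IsDeflationClass

end Deflations

/-! ### The modules `Ext^i(M, E)` for `i = 0, 1, 2` -/

section ExtModules

open Abelian

variable {C : Type u} [Category.{v} C] [Preadditive C]

/-- A length two resolution splits into two short exact sequences. -/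
lemma exists_shortExact {X Y Z : C} {f : X ⟶ Y} {g : Y ⟶ Z} {M : Modules C}
    {p : (P C).obj Z ⟶ M} (hk : IsKer f g) (hp : IsPresentation g p) :
    ∃ (K : Modules C) (q : (P C).obj Y ⟶ K) (i : K ⟶ (P C).obj Z) (w : (P C).map f ≫ q = 0)
      (w' : i ≫ p = 0), (ShortComplex.mk _ _ w).ShortExact ∧ (ShortComplex.mk _ _ w').ShortExact ∧
      q ≫ i = (P C).map g := by
  have hp_epi := hp.epi
  obtain ⟨hm, ⟨w₁, h₁⟩, -, -⟩ := isRes_map_iff.2 ⟨hk, hp⟩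
  have hqi : kernel.lift p ((P C).map g) hp.zero ≫ kernel.ι p = (P C).map g := kernel.lift_ι _ _ _
  refine ⟨kernel p, kernel.lift p ((P C).map g) hp.zero, kernel.ι p, ?_, kernel.condition p,
    { exact := ?_, epi_g := ?_ }, ⟨ShortComplex.exact_kernel p⟩, hqi⟩
  · rw [← cancel_mono (kernel.ι p), Category.assoc, hqi, w₁, zero_comp]
  · refine exact_of_lift _ fun T x hx => exact_lift h₁ x ?_
    change x ≫ (P C).map g = 0
    refine (congrArg (x ≫ ·) hqi.symm).trans ?_
    rw [← Category.assoc]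
    exact (congrArg (· ≫ kernel.ι p) hx).trans zero_comp
  · refine epi_of_lift _ fun T y => ?_
    obtain ⟨x, hx⟩ := exact_lift hp.exact (y ≫ kernel.ι p) (by simp)
    exact ⟨x, by rw [← cancel_mono (kernel.ι p), Category.assoc, ← hx]; exact congrArg (x ≫ ·) hqi⟩

variable [EssentiallySmall.{v} C]

lemma isZero_extModule_iff (M : Modules C) (i : ℕ) :
    IsZero (extModule M i) ↔ ∀ (W : C) (x : Ext M ((P C).obj W) i), x = 0 := by
  rw [IsZero.iff_id_eq_zero]
  constructor
  · intro h W x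
    have := congrArg (fun φ : extModule M i ⟶ extModule M i => φ.hom.app (op (op W)) x) h
    exact this
  · intro h
    refine ObjectProperty.hom_ext _ (NatTrans.ext (funext fun ⟨⟨W⟩⟩ => ?_))
    ext x
    exact h W x

/-- The element of `Ext^i(M, E)` given by an extension class. -/
noncomputable def extElement {M : Modules C} {i : ℕ} {W : C} (x : Ext M ((P C).obj W) i) :
    (P Cᵒᵖ).obj (op W) ⟶ extModule M i :=
  ofElement (C := Cᵒᵖ) (X := op W) (M := extModule M i) x

lemma extElement_bijective {M : Modules C} {i : ℕ} {W : C} :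
    Function.Bijective (extElement (M := M) (i := i) (W := W)) :=
  ofElement_bijective (C := Cᵒᵖ) (X := op W) (M := extModule M i)

lemma extElement_zero {M : Modules C} {i : ℕ} {W : C} :
    extElement (0 : Ext M ((P C).obj W) i) = 0 := by
  refine hom_ext_of_app_id _ _ ?_
  exact ofElement_app_id (C := Cᵒᵖ) (X := op W) (M := extModule M i) _

lemma map_op_comp_extElement {M : Modules C} {i : ℕ} {X W : C} (u : X ⟶ W)
    (x : Ext M ((P C).obj X) i) : (P Cᵒᵖ).map u.op ≫ extElement x =
      extElement (x.comp (Ext.mk₀ ((P C).map u)) (add_zero i)) := by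
  refine hom_ext_of_app_id _ _ ?_
  refine Eq.trans ?_ (ofElement_app_id (C := Cᵒᵖ) (X := op W) (M := extModule M i) _).symm
  change x.comp (Ext.mk₀ ((P C).map (u ≫ 𝟙 W))) (add_zero i) = _
  rw [Category.comp_id]

lemma isZero_extModule_zero {X Y Z : C} {f : X ⟶ Y} {g : Y ⟶ Z} {M : Modules C}
    {p : (P C).obj Z ⟶ M} (hp : IsPresentation g p) (hc : IsCoker f g) : IsZero (extModule M 0) := by
  rw [isZero_extModule_iff]
  intro W x
  obtain ⟨m, rfl⟩ := (Ext.mk₀_bijective _ _).2 x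
  have := hc.epi
  have := hp.epi
  obtain ⟨u, hu⟩ := (P C).map_surjective (p ≫ m)
  have : u = 0 := by
    rw [← cancel_epi g, comp_zero, ← P_map_eq_zero_iff, (P C).map_comp, hu, ← Category.assoc,
      hp.zero, zero_comp]
  have : m = 0 := by rw [← cancel_epi p, ← hu, this, (P C).map_zero, comp_zero]
  rw [this, Ext.mk₀_zero]

section

variable {X Y Z : C} {f : X ⟶ Y} {g : Y ⟶ Z} {M : Modules C} {p : (P C).obj Z ⟶ M}
  (hk : IsKer f g) (hp : IsPresentation g p)
include hk hp

/-- A morphism killed by `g` factors through `M`, so `Ext⁰ = 0` makes `g` epi. A morphism `u` with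
`f ≫ u = 0` descends to the image `K` of `P_g`, and the obstruction to extending it from `K` to
`P_Z` lies in `Ext¹(M, E)`. -/
lemma isCoker_of_isZero_extModule (h₀ : IsZero (extModule M 0)) (h₁ : IsZero (extModule M 1)) :
    IsCoker f g where
  zero := hk.zero
  epi := by
    refine Preadditive.epi_of_cancel_zero g fun {W} u hu => ?_
    obtain ⟨m, hm⟩ := hp.desc ((P C).map u) (by rw [← (P C).map_comp, hu, (P C).map_zero])
    have : m = 0 := (Ext.mk₀_bijective _ _).1 (by
      rw [(isZero_extModule_iff M 0).1 h₀ W (Ext.mk₀ m), Ext.mk₀_zero])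
    rw [← P_map_eq_zero_iff, ← hm, this, comp_zero]
  desc {W} u hu := by
    obtain ⟨K, q, i, w, w', hS, hS', hqi⟩ := exists_shortExact hk hp
    have := hS.epi_g
    obtain ⟨n, hn⟩ : ∃ n : K ⟶ (P C).obj W, q ≫ n = (P C).map u :=
      ⟨hS.exact.desc ((P C).map u) (by rw [← (P C).map_comp, hu, (P C).map_zero]),
        hS.exact.g_desc _ _⟩
    obtain ⟨x, hx⟩ := Ext.contravariant_sequence_exact₁ hS' ((P C).obj W) (Ext.mk₀ n)
      (add_zero 1) ((isZero_extModule_iff M 1).1 h₁ W _)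
    obtain ⟨x, rfl⟩ := (Ext.mk₀_bijective _ _).2 x
    obtain ⟨x, rfl⟩ := (P C).map_surjective x
    rw [Ext.mk₀_comp_mk₀] at hx
    refine ⟨x, (P C).map_injective ?_⟩
    rw [(P C).map_comp, ← hn, ← (Ext.mk₀_bijective _ _).1 hx, ← hqi, Category.assoc]

/-- Every class in `Ext¹(M, P_W)` comes from a morphism on the image `K` of `P_g`. Pulled back to
`P_Y` it is killed by `f`, so it factors through `g`; thus it extends to `P_Z` and its class is
zero. -/
lemma isZero_extModule_one (hc : IsCoker f g) : IsZero (extModule M 1) := by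
  rw [isZero_extModule_iff]
  intro W x
  obtain ⟨K, q, i, w, w', hS, hS', hqi⟩ := exists_shortExact hk hp
  obtain ⟨n, rfl⟩ := Ext.contravariant_sequence_exact₃ hS' _ x (Ext.eq_zero_of_projective _)
    (add_zero 1)
  obtain ⟨n, rfl⟩ := (Ext.mk₀_bijective _ _).2 n
  obtain ⟨u, hu⟩ := (P C).map_surjective (q ≫ n)
  obtain ⟨y, rfl⟩ := hc.desc u (by
    rw [← P_map_eq_zero_iff, (P C).map_comp, hu, ← Category.assoc, w, zero_comp])
  have hq : Epi q := hS.epi_g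
  have : n = i ≫ (P C).map y := by
    rw [← cancel_epi q, ← hu, (P C).map_comp, ← hqi, Category.assoc]
  subst this
  rw [← Ext.mk₀_comp_mk₀]
  exact hS'.extClass_comp_assoc _

/-- `Ext²(M, E)` is presented by the opposite of the resolution of `M`. -/
lemma exists_isPresentation_extModule_two :
    ∃ π : (P Cᵒᵖ).obj (op X) ⟶ extModule M 2, IsPresentation f.op π := by
  obtain ⟨K, q, i, w, w', hS, hS', hqi⟩ := exists_shortExact hk hp
  -- The Yoneda class of the resolution. It generates `Ext²(M, E)` by dimension shifting, as `P_Y`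
  -- and `P_Z` have no higher `Ext`.
  let θ : Ext M ((P C).obj X) 2 := hS'.extClass.comp hS.extClass rfl
  have hθ : ∀ {W : C} (u : (P C).obj X ⟶ (P C).obj W),
      θ.comp (Ext.mk₀ u) (add_zero 2) =
        hS'.extClass.comp (hS.extClass.comp (Ext.mk₀ u) (add_zero 1)) rfl :=
    fun u => Ext.comp_assoc_of_third_deg_zero _ _ _ _
  refine ⟨extElement θ, ?_, ?_, ?_⟩
  · refine epi_of_lift _ fun ⟨W⟩ y => ?_
    obtain ⟨y, rfl⟩ := extElement_bijective.2 y
    obtain ⟨n, hn⟩ := Ext.contravariant_sequence_exact₃ hS' ((P C).obj W) y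
      (Ext.eq_zero_of_projective _) (rfl : 1 + 1 = 2)
    obtain ⟨m, hm⟩ := Ext.contravariant_sequence_exact₃ hS ((P C).obj W) n
      (Ext.eq_zero_of_projective _) (rfl : 1 + 0 = 1)
    obtain ⟨m, rfl⟩ := (Ext.mk₀_bijective _ _).2 m
    obtain ⟨u, rfl⟩ := (P C).map_surjective m
    refine ⟨(P Cᵒᵖ).map u.op, ?_⟩
    rw [map_op_comp_extElement, hθ, hm, hn]
  · rw [map_op_comp_extElement, hθ, hS.extClass_comp, Ext.comp_zero, extElement_zero]
  · rintro ⟨W⟩ u hu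
    rw [← u.op_unop, map_op_comp_extElement, ← extElement_zero] at hu
    replace hu := extElement_bijective.1 hu
    rw [hθ] at hu
    -- Dimension shifting backwards: the product of `hS.extClass` with `u` comes from `Ext¹(P_Z,
    -- P_W) = 0`, so `u` extends along `P_f`.
    obtain ⟨x, hx⟩ := Ext.contravariant_sequence_exact₁ hS' _ _ _ hu
    obtain ⟨y, hy⟩ := Ext.contravariant_sequence_exact₁ hS _ (Ext.mk₀ ((P C).map u.unop))
      (add_zero 1) (by rw [← hx, Ext.eq_zero_of_projective x, Ext.comp_zero])
    obtain ⟨y, rfl⟩ := (Ext.mk₀_bijective _ _).2 y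
    obtain ⟨y, rfl⟩ := (P C).map_surjective y
    rw [Ext.mk₀_comp_mk₀] at hy
    refine ⟨y.op, Quiver.Hom.unop_inj ((P C).map_injective ?_)⟩
    rw [← (Ext.mk₀_bijective _ _).1 hy]
    exact (P C).map_comp _ _

end

end ExtModules

/-! ### Existence of kernels -/

section Schanuel

variable {C : Type u} [Category.{v} C] [Preadditive C]

/-- A variant of Schanuel's lemma: if `M` has a resolution of length two by representable modules,
then in every presentation of `M` the morphism has a kernel. -/
lemma IsPresentation.exists_isKer [HasBinaryBiproducts C] [IsIdempotentComplete C] {A B V : C}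
    {f₀ : A ⟶ B} {g₀ : B ⟶ V} (hk : IsKer f₀ g₀) {M : Modules C} {p : (P C).obj V ⟶ M}
    (hp : IsPresentation g₀ p) {Y Z : C} {g : Y ⟶ Z} {q : (P C).obj Z ⟶ M}
    (hq : IsPresentation g q) : ∃ (K : C) (k : K ⟶ Y), IsKer k g := by
  have := hp.epi
  have := hq.epi
  have := hk.mono
  obtain ⟨z, hz⟩ := exists_map_lift p q
  obtain ⟨w, hw⟩ := exists_map_lift q p
  obtain ⟨y, hy⟩ := hp.lift (g ≫ z) (by rw [(P C).map_comp, Category.assoc, hz, hq.zero])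
  obtain ⟨b, hb⟩ := hq.lift (g₀ ≫ w) (by rw [(P C).map_comp, Category.assoc, hw, hp.zero])
  obtain ⟨c, hc⟩ := hq.lift (𝟙 Z - z ≫ w) (by
    simp only [(P C).map_sub, (P C).map_comp, (P C).map_id, Preadditive.sub_comp,
      Category.id_comp, Category.assoc, hw, hz, sub_self])
  -- `h` is the identity minus the round trip through `B`, corrected by the homotopy `c` to land in
  -- the kernel of `g`. The map `r` adds the part of the round trip through `A`. If `t ≫ g = 0` and
  -- `s ≫ f₀ = t ≫ y`, then `r` sends `(s, t)` back to `t`; so the kernel of `g`, as a functor, is a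
  -- retract of `A ⊞ Y`.
  let h : Y ⟶ Y := 𝟙 Y - y ≫ b - g ≫ c
  have hh : h ≫ g = 0 := by
    simp only [h, Preadditive.sub_comp, Category.assoc, Category.id_comp, hb, hc,
      Preadditive.comp_sub, Category.comp_id, reassoc_of% hy, sub_self]
  let r : A ⊞ Y ⟶ Y := biprod.fst ≫ f₀ ≫ b + biprod.snd ≫ h
  have hr : r ≫ g = 0 := by
    simp only [r, Preadditive.add_comp, Category.assoc, hb, hh, reassoc_of% hk.zero, zero_comp,
      comp_zero, add_zero]
  obtain ⟨a, ha⟩ := hk.lift (r ≫ y) (by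
    rw [Category.assoc, hy, reassoc_of% hr, zero_comp])
  have key : ∀ {T : C} (s : T ⟶ A) (t : T ⟶ Y), t ≫ g = 0 → s ≫ f₀ = t ≫ y →
      biprod.lift s t ≫ r = t := by
    intro T s t ht hs
    simp only [r, h, Preadditive.comp_add, biprod.lift_fst_assoc, biprod.lift_snd_assoc,
      Preadditive.comp_sub, Category.comp_id, reassoc_of% ht, zero_comp, sub_zero,
      reassoc_of% hs, add_sub_cancel, biprod.lift_snd]
  -- The idempotent of this retract: `r` followed by the section `t ↦ (s, t)`. Its splitting
  -- represents the kernel of `g`.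
  let ε : A ⊞ Y ⟶ A ⊞ Y := biprod.lift a r
  have hεr : ε ≫ r = r := key a r hr ha
  have hεa : ε ≫ a = a := by
    rw [← cancel_mono f₀, Category.assoc, ha, ← Category.assoc, hεr]
  have hε : ε ≫ ε = ε := by
    refine biprod.hom_ext _ _ ?_ ?_
    · rw [Category.assoc, biprod.lift_fst, hεa]
    · rw [Category.assoc, biprod.lift_snd, hεr]
  obtain ⟨K, i, e, hie, hei⟩ := IsIdempotentComplete.idempotents_split _ ε hε
  have hi : i ≫ ε = i := by rw [← hei, ← Category.assoc, hie, Category.id_comp]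
  refine ⟨K, i ≫ r, Preadditive.mono_of_cancel_zero _ fun {T} x hx => ?_, ?_, fun {T} x hx => ?_⟩
  · have h₁ : x ≫ i ≫ a = 0 := by
      rw [← cancel_mono f₀, Category.assoc, Category.assoc, ha, zero_comp]
      simpa using congrArg (· ≫ y) hx
    have h₂ : x ≫ i = 0 := by
      rw [← hi]
      refine biprod.hom_ext _ _ ?_ ?_
      · simpa [ε] using h₁
      · simpa [ε] using hx
    rw [← Category.comp_id x, ← hie, ← Category.assoc, h₂, zero_comp]
  · rw [Category.assoc, hr, comp_zero]
  · obtain ⟨s, hs⟩ := hk.lift (x ≫ y) (by rw [Category.assoc, hy, reassoc_of% hx, zero_comp])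
    refine ⟨biprod.lift s x ≫ e, ?_⟩
    rw [Category.assoc, ← Category.assoc e, hei, hεr, key s x hx hs]

end Schanuel

/-! ### From Serre subcategories to deflations -/

section Deflations

variable {C : Type u} [Category.{v} C] [Preadditive C]

/-- The objects of `G` have resolutions of length two by representable modules. -/
def HasResolutions (G : ObjectProperty (Modules C)) : Prop :=
  ∀ M, G M → ∃ (X Y Z : C) (f : X ⟶ Y) (g : Y ⟶ Z) (p : (P C).obj Z ⟶ M),
    IsKer f g ∧ IsPresentation g p

variable [HasBinaryBiproducts C] [IsIdempotentComplete C] {G : ObjectProperty (Modules C)}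

/-- The Schanuel argument supplies the kernel, so being a deflation is a condition on the cokernel
module alone. -/
lemma isDeflation_conflationsOf_iff (hres : HasResolutions G) {Y Z : C} (g : Y ⟶ Z) :
    IsDeflation (conflationsOf G) g ↔
      ∃ (M : Modules C) (p : (P C).obj Z ⟶ M), G M ∧ IsPresentation g p := by
  constructor
  · rintro ⟨X, f, w, M, p, h, hM⟩
    exact ⟨M, p, hM, (isRes_map_iff.1 h).2⟩
  · rintro ⟨M, p, hM, hp⟩
    obtain ⟨_, _, _, f₀, g₀, p₀, hk₀, hp₀⟩ := hres M hM
    obtain ⟨X, f, hf⟩ := IsPresentation.exists_isKer hk₀ hp₀ hp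
    exact ⟨X, f, hf.zero, M, p, isRes_map_iff.2 ⟨hf, hp⟩, hM⟩

omit [HasBinaryBiproducts C] [IsIdempotentComplete C] in
/-- The image of a morphism of modules. -/
lemma exists_image {N M : Modules C} (m : N ⟶ M) :
    ∃ (L : Modules C) (l : N ⟶ L) (i : L ⟶ M), Epi l ∧ l ≫ i = m ∧
      (ShortComplex.mk i (cokernel.π i) (cokernel.condition i)).ShortExact :=
  ⟨Abelian.image m, Abelian.factorThruImage m, Abelian.image.ι m, inferInstance,
    Abelian.image.fac m, { exact := ShortComplex.exact_cokernel _ }⟩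

/-- Up to sign, the pullback of `g` and `h` is the kernel of `(g h) : Y ⊞ W ⟶ Z`, which presents `M
/ L` for `L` the image of `P_W` in `M`. The Serre condition puts both `M / L` and `L` in `G`: the
former makes the kernel exist, the latter makes the pulled back morphism a deflation. -/
lemma isDeflation_pullback (hres : HasResolutions G) (hG : IsSerreInFinGen G) {Y Z W : C}
    (g : Y ⟶ Z) (h : W ⟶ Z) (hg : IsDeflation (conflationsOf G) g) :
    ∃ (A : C) (l : A ⟶ Y) (k : A ⟶ W), IsPullback l k g h ∧
      IsDeflation (conflationsOf G) k := by
  obtain ⟨M, p, hM, hp⟩ := (isDeflation_conflationsOf_iff hres g).1 hg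
  obtain ⟨L, l, i, hl, hli, hS⟩ := exists_image ((P C).map h ≫ p)
  have hN := hp.quotient hS hli.symm
  have hLN := (hG.iff_of_shortExact _ hS ⟨W, l, hl⟩ hp.finGen hN.finGen).1 hM
  obtain ⟨_, _, _, f₀, g₀, p₀, hk₀, hp₀⟩ := hres _ hLN.2
  obtain ⟨A, k, hk⟩ := hp₀.exists_isKer hk₀ hN
  have hk_mono := hk.mono
  have hk_zero : (k ≫ biprod.fst) ≫ g + (k ≫ biprod.snd) ≫ h = 0 := by
    have := hk.zero
    rw [biprod.desc_eq] at this
    simpa using this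
  have hlift (s : PullbackCone g h) : biprod.lift s.fst (-s.snd) ≫ biprod.desc g h = 0 := by
    rw [biprod.lift_desc, Preadditive.neg_comp, s.condition, add_neg_cancel]
  have sq : IsPullback (k ≫ biprod.fst) (-(k ≫ biprod.snd)) g h := by
    refine ⟨⟨by rw [Preadditive.neg_comp]; exact eq_neg_of_add_eq_zero_left hk_zero⟩,
      ⟨PullbackCone.IsLimit.mk _
        (fun s => (hk.lift _ (hlift s)).choose) (fun s => ?_) (fun s => ?_)
        (fun s m h₁ h₂ => ?_)⟩⟩
    · rw [← Category.assoc, (hk.lift _ (hlift s)).choose_spec, biprod.lift_fst]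
    · rw [Preadditive.comp_neg, ← Category.assoc,
        (hk.lift _ (hlift s)).choose_spec, biprod.lift_snd, neg_neg]
    · rw [← cancel_mono k, (hk.lift _ (hlift s)).choose_spec]
      refine biprod.hom_ext _ _ ?_ ?_
      · rw [biprod.lift_fst, ← h₁, Category.assoc]
      · rw [biprod.lift_snd, ← h₂, Preadditive.comp_neg, neg_neg, Category.assoc]
  exact ⟨A, _, _, sq, (isDeflation_conflationsOf_iff hres _).2
    ⟨L, l, hLN.1, hp.sub hS hli.symm sq⟩⟩

/-- The morphism `g₂` induces `m : M₁ ⟶ M` into the cokernel `M` of the composite, and the cokernel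
of `m` is `M₂`. The image `L` of `m` is in `G` as a quotient of `M₁`, so `M` is in `G` as an
extension of `M₂` by `L`. -/
lemma isDeflation_comp (hres : HasResolutions G) (hG : IsSerreInFinGen G) {Y Z V : C}
    (g₁ : Y ⟶ Z) (g₂ : Z ⟶ V) (hg₁ : IsDeflation (conflationsOf G) g₁)
    (hg₂ : IsDeflation (conflationsOf G) g₂) : IsDeflation (conflationsOf G) (g₁ ≫ g₂) := by
  have := hG.closedUnderIso
  obtain ⟨M₁, p₁, hM₁, hp₁⟩ := (isDeflation_conflationsOf_iff hres g₁).1 hg₁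
  obtain ⟨X₂, f₂, w₂, M₂, p₂, hr₂, hM₂⟩ := hg₂
  obtain ⟨hk₂, hp₂⟩ := isRes_map_iff.1 hr₂
  obtain ⟨M, p, hp⟩ : ∃ (M : Modules C) (p : (P C).obj V ⟶ M), IsPresentation (g₁ ≫ g₂) p :=
    ⟨_, _, isPresentation_cokernel _⟩
  have hp_epi := hp.epi
  have hp₁_epi := hp₁.epi
  obtain ⟨m, hm⟩ := hp₁.desc ((P C).map g₂ ≫ p) (by
    rw [← Category.assoc, ← (P C).map_comp, hp.zero])
  obtain ⟨L, l, i, hl, hli, hS⟩ := exists_image m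
  have hi_mono : Mono i := hS.mono_f
  have hS' : (ShortComplex.mk (kernel.ι l) l (kernel.condition l)).ShortExact :=
    { exact := ShortComplex.exact_kernel l }
  have lift {T : C} (x : T ⟶ Z) (hx : (P C).map x ≫ (P C).map g₂ ≫ p = 0) :
      ∃ y z, x = y ≫ g₁ + z ≫ f₂ := by
    obtain ⟨y, hy⟩ := hp.lift (x ≫ g₂) (by rw [(P C).map_comp, Category.assoc, hx])
    obtain ⟨z, hz⟩ := hk₂.lift (x - y ≫ g₁) (by
      rw [Preadditive.sub_comp, Category.assoc, hy, sub_self])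
    exact ⟨y, z, by rw [hz, add_sub_cancel]⟩
  -- A Serre subcategory of `mod E` controls only quotients with finitely generated kernel; here
  -- `f₂` supplies the generators.
  have hK : finGen C (kernel l) := by
    refine ⟨X₂, kernel.lift l ((P C).map f₂ ≫ p₁) ?_, epi_of_lift _ fun T y => ?_⟩
    · rw [← cancel_mono i, Category.assoc, Category.assoc, hli, hm, ← Category.assoc,
        ← (P C).map_comp, hk₂.zero, (P C).map_zero, zero_comp, zero_comp]
    · obtain ⟨x, hx⟩ := exists_map_lift p₁ (y ≫ kernel.ι l)
      obtain ⟨z, t, rfl⟩ := lift x (by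
        rw [← hm, ← Category.assoc, hx, ← hli, Category.assoc, kernel.condition_assoc, zero_comp,
          comp_zero])
      refine ⟨(P C).map t, ?_⟩
      rw [← cancel_mono (kernel.ι l), ← hx, Category.assoc, kernel.lift_ι, (P C).map_add,
        Preadditive.add_comp, (P C).map_comp, (P C).map_comp, Category.assoc, Category.assoc,
        hp₁.zero, comp_zero, zero_add]
  have hL := ((hG.iff_of_shortExact _ hS' hK hp₁.finGen (finGen_of_epi l hp₁.finGen)).1 hM₁).2
  have hN : IsPresentation g₂ (p ≫ cokernel.π i) := by
    refine ⟨inferInstance, ?_, fun {T} x hx => ?_⟩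
    · rw [← Category.assoc, ← hm, ← hli, Category.assoc, Category.assoc, cokernel.condition,
        comp_zero, comp_zero]
    · obtain ⟨y, hy⟩ := exact_lift hS.exact ((P C).map x ≫ p) ((Category.assoc _ _ _).trans hx)
      obtain ⟨y, rfl⟩ := exists_lift l y
      obtain ⟨z, rfl⟩ := exists_map_lift p₁ y
      change (_ ≫ l) ≫ i = _ at hy
      obtain ⟨t, ht⟩ := hp.lift (x - z ≫ g₂) (by
        rw [(P C).map_sub, Preadditive.sub_comp, ← hy, Category.assoc, hli, Category.assoc, hm,
          (P C).map_comp, Category.assoc, sub_self])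
      exact ⟨z + t ≫ g₁, by rw [Preadditive.add_comp, Category.assoc, ht, add_sub_cancel]⟩
  obtain ⟨e⟩ := hp₂.unique hN
  exact (isDeflation_conflationsOf_iff hres _).2 ⟨M, p, (hG.iff_of_shortExact _ hS
    (finGen_of_epi l hp₁.finGen) hp.finGen hN.finGen).2 ⟨hL, G.prop_of_iso e hM₂⟩, hp⟩

end Deflations

/-! ### Homotopy invariance of resolutions -/

section Homotopy

variable {C : Type u} [Category.{v} C] [Preadditive C]

/-- A morphism from the complex `X ⟶ Y ⟶ Z` to `X' ⟶ Y' ⟶ Z'`. -/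
structure ComplexHom {X Y Z X' Y' Z' : C} (f : X ⟶ Y) (g : Y ⟶ Z) (f' : X' ⟶ Y')
    (g' : Y' ⟶ Z') where
  φ₁ : X ⟶ X'
  φ₂ : Y ⟶ Y'
  φ₃ : Z ⟶ Z'
  comm₁ : φ₁ ≫ f' = f ≫ φ₂
  comm₂ : φ₂ ≫ g' = g ≫ φ₃

/-- The composition of `φ` and `ψ` is homotopic to the identity. -/
def IsHomotopyInverse {X Y Z X' Y' Z' : C} {f : X ⟶ Y} {g : Y ⟶ Z} {f' : X' ⟶ Y'}
    {g' : Y' ⟶ Z'} (φ : ComplexHom f g f' g') (ψ : ComplexHom f' g' f g) : Prop :=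
  ∃ (s : Z ⟶ Y) (t : Y ⟶ X), 𝟙 Z = φ.φ₃ ≫ ψ.φ₃ + s ≫ g ∧
    𝟙 Y = φ.φ₂ ≫ ψ.φ₂ + g ≫ s + t ≫ f ∧ 𝟙 X = φ.φ₁ ≫ ψ.φ₁ + f ≫ t

variable {X Y Z X' Y' Z' : C}

/-- The opposite of a morphism of complexes in `Cᵒᵖ`. -/
def ComplexHom.unop {X Y Z X' Y' Z' : Cᵒᵖ} {f : X ⟶ Y} {g : Y ⟶ Z} {f' : X' ⟶ Y'} {g' : Y' ⟶ Z'}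
    (φ : ComplexHom f g f' g') : ComplexHom g'.unop f'.unop g.unop f.unop where
  φ₁ := φ.φ₃.unop
  φ₂ := φ.φ₂.unop
  φ₃ := φ.φ₁.unop
  comm₁ := by rw [← unop_comp, ← unop_comp, φ.comm₂]
  comm₂ := by rw [← unop_comp, ← unop_comp, φ.comm₁]

lemma IsHomotopyInverse.unop {X Y Z X' Y' Z' : Cᵒᵖ} {f : X ⟶ Y} {g : Y ⟶ Z} {f' : X' ⟶ Y'}
    {g' : Y' ⟶ Z'} {φ : ComplexHom f g f' g'} {ψ : ComplexHom f' g' f g}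
    (h : IsHomotopyInverse φ ψ) : IsHomotopyInverse ψ.unop φ.unop := by
  obtain ⟨s, t, h₃, h₂, h₁⟩ := h
  refine ⟨t.unop, s.unop, congrArg Quiver.Hom.unop h₁, ?_, congrArg Quiver.Hom.unop h₃⟩
  refine (congrArg Quiver.Hom.unop h₂).trans ?_
  rw [add_right_comm]
  rfl

variable {f : X ⟶ Y} {g : Y ⟶ Z} {f' : X' ⟶ Y'} {g' : Y' ⟶ Z'}

lemma exists_complexHom (hfg : f ≫ g = 0) {M : Modules C} {p : (P C).obj Z ⟶ M}
    (hp : IsPresentation g p) (hk' : IsKer f' g') {p' : (P C).obj Z' ⟶ M}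
    (hp' : IsPresentation g' p') :
    ∃ φ : ComplexHom f g f' g', (P C).map φ.φ₃ ≫ p' = p := by
  have := hp'.epi
  obtain ⟨φ₃, h₃⟩ := exists_map_lift p' p
  obtain ⟨φ₂, h₂⟩ := hp'.lift (g ≫ φ₃) (by rw [(P C).map_comp, Category.assoc, h₃, hp.zero])
  obtain ⟨φ₁, h₁⟩ := hk'.lift (f ≫ φ₂) (by
    rw [Category.assoc, h₂, ← Category.assoc, hfg, zero_comp])
  exact ⟨⟨φ₁, φ₂, φ₃, h₁, h₂⟩, h₃⟩

lemma isHomotopyInverse_of_resolution (hk : IsKer f g) {M : Modules C} {p : (P C).obj Z ⟶ M}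
    (hp : IsPresentation g p) {p' : (P C).obj Z' ⟶ M} (φ : ComplexHom f g f' g')
    (hφ : (P C).map φ.φ₃ ≫ p' = p) (ψ : ComplexHom f' g' f g)
    (hψ : (P C).map ψ.φ₃ ≫ p = p') : IsHomotopyInverse φ ψ := by
  have := hk.mono
  obtain ⟨s, hs⟩ := hp.lift (𝟙 Z - φ.φ₃ ≫ ψ.φ₃) (by
    rw [(P C).map_sub, Preadditive.sub_comp, (P C).map_comp, Category.assoc, hψ, hφ,
      (P C).map_id, Category.id_comp, sub_self])
  obtain ⟨t, ht⟩ := hk.lift (𝟙 Y - φ.φ₂ ≫ ψ.φ₂ - g ≫ s) (by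
    simp only [Preadditive.sub_comp, Category.assoc, hs, ψ.comm₂, Preadditive.comp_sub,
      Category.id_comp, Category.comp_id, ← reassoc_of% φ.comm₂, sub_self])
  refine ⟨s, t, by rw [hs, add_sub_cancel], by rw [ht]; abel, ?_⟩
  rw [← cancel_mono f]
  simp only [Preadditive.add_comp, Category.assoc, ht, ψ.comm₁, Preadditive.comp_sub,
      Category.id_comp, Category.comp_id, ← reassoc_of% φ.comm₁, reassoc_of% hk.zero, zero_comp]
  abel

/-- One homotopy suffices: `f', g'` is a retract of `f, g` up to homotopy, and exactness of `Hom(-,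
T)` passes to such retracts. -/
lemma IsCoker.of_homotopy {φ : ComplexHom f g f' g'} {ψ : ComplexHom f' g' f g}
    (h : IsHomotopyInverse ψ φ) (hfg' : f' ≫ g' = 0) (hc : IsCoker f g) : IsCoker f' g' := by
  obtain ⟨s, t, h₃, h₂, h₁⟩ := h
  have := hc.epi
  refine ⟨Preadditive.epi_of_cancel_zero _ fun {T} u hu => ?_, hfg', fun {T} u hu => ?_⟩
  · have : φ.φ₃ ≫ u = 0 := by
      rw [← cancel_epi g, ← Category.assoc, ← φ.comm₂, Category.assoc, hu, comp_zero, comp_zero]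
    rw [← Category.id_comp u, h₃, Preadditive.add_comp, Category.assoc, this, Category.assoc, hu,
      comp_zero, comp_zero, add_zero]
  · obtain ⟨w, hw⟩ := hc.desc (φ.φ₂ ≫ u) (by
      rw [← Category.assoc, ← φ.comm₁, Category.assoc, hu, comp_zero])
    refine ⟨ψ.φ₃ ≫ w + s ≫ u, ?_⟩
    conv_rhs => rw [← Category.id_comp u, h₂]
    simp only [Preadditive.comp_add, Preadditive.add_comp, Category.assoc, hu, comp_zero, add_zero,
      ← reassoc_of% ψ.comm₂, hw]

/-- The homotopy on `Z` gives surjectivity, the one on `Z'` gives exactness at `P_Z'`. -/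
lemma IsPresentation.of_homotopy {φ : ComplexHom f g f' g'} {ψ : ComplexHom f' g' f g}
    (h : IsHomotopyInverse φ ψ) (h' : IsHomotopyInverse ψ φ) {M : Modules C}
    {p : (P C).obj Z ⟶ M} (hp : IsPresentation g p) :
    IsPresentation g' ((P C).map ψ.φ₃ ≫ p) := by
  obtain ⟨s, t, h₃, -, -⟩ := h
  obtain ⟨s', t', h₃', -, -⟩ := h'
  have := hp.epi
  refine ⟨?_, ?_, fun {T} x hx => ?_⟩
  · have : (P C).map φ.φ₃ ≫ (P C).map ψ.φ₃ ≫ p = p := by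
      have := congrArg (fun u => (P C).map u ≫ p) h₃
      simp only [(P C).map_id, Category.id_comp, (P C).map_add, (P C).map_comp,
        Preadditive.add_comp, Category.assoc, hp.zero, comp_zero, add_zero] at this
      exact this.symm
    exact epi_of_epi_fac this
  · rw [← Category.assoc, ← (P C).map_comp, ← ψ.comm₂, (P C).map_comp, Category.assoc, hp.zero,
      comp_zero]
  · obtain ⟨y, hy⟩ := hp.lift (x ≫ ψ.φ₃) (by rw [(P C).map_comp, Category.assoc, hx])
    refine ⟨y ≫ φ.φ₂ + x ≫ s', ?_⟩
    conv_rhs => rw [← Category.comp_id x, h₃']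
    simp only [Preadditive.comp_add, Preadditive.add_comp, Category.assoc, φ.comm₂,
      reassoc_of% hy]

end Homotopy

/-! ### Duality between `D` and `Ext²(D, E)` -/

section Duality

variable {C : Type u} [Category.{v} C] [Preadditive C] [EssentiallySmall.{v} C]

lemma C₂_iff (M : Modules C) : C₂ C M ↔ ∃ (X Y Z : C) (f : X ⟶ Y) (g : Y ⟶ Z)
    (p : (P C).obj Z ⟶ M), IsKer f g ∧ IsCoker f g ∧ IsPresentation g p := by
  constructor
  · rintro ⟨⟨X, Y, Z, a, b, p, h⟩, h₀, h₁⟩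
    obtain ⟨f, rfl⟩ := (P C).map_surjective a
    obtain ⟨g, rfl⟩ := (P C).map_surjective b
    obtain ⟨hk, hp⟩ := isRes_map_iff.1 h
    exact ⟨X, Y, Z, f, g, p, hk, isCoker_of_isZero_extModule hk hp h₀ h₁, hp⟩
  · rintro ⟨X, Y, Z, f, g, p, hk, hc, hp⟩
    exact ⟨⟨X, Y, Z, _, _, p, isRes_map_iff.2 ⟨hk, hp⟩⟩, isZero_extModule_zero hp hc,
      isZero_extModule_one hk hp hc⟩

lemma isCoker_of_C₂ {M : Modules C} (hM : C₂ C M) {X Y Z : C} {f : X ⟶ Y} {g : Y ⟶ Z}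
    {p : (P C).obj Z ⟶ M} (hk : IsKer f g) (hp : IsPresentation g p) : IsCoker f g :=
  isCoker_of_isZero_extModule hk hp hM.2.1 hM.2.2

lemma hasResolutions_of_le_C₂ {D : ObjectProperty (Modules C)} (hD : D ≤ C₂ C) :
    HasResolutions D := by
  intro M hM
  obtain ⟨X, Y, Z, f, g, p, hk, -, hp⟩ := (C₂_iff M).1 (hD M hM)
  exact ⟨X, Y, Z, f, g, p, hk, hp⟩

/-- The opposite of a resolution of `M` resolves `Ext²(M, E)`, since the cokernel property dualizes
to a kernel property. -/
lemma hasResolutions_ext₂Image {D : ObjectProperty (Modules C)} (hD : D ≤ C₂ C) :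
    HasResolutions (ext₂Image D) := by
  rintro N ⟨M, hM, ⟨e⟩⟩
  obtain ⟨X, Y, Z, f, g, p, hk, hc, hp⟩ := (C₂_iff M).1 (hD M hM)
  obtain ⟨π, hπ⟩ := exists_isPresentation_extModule_two hk hp
  exact ⟨_, _, _, g.op, f.op, _, hc.op, hπ.of_iso e.symm⟩

/-- The inflations of `F(D)` are the opposites of the deflations of `F(Ext²(D, E))`. -/
lemma isInflation_conflationsOf_iff {D : ObjectProperty (Modules C)} (hD : D ≤ C₂ C) {X Y : C}
    (f : X ⟶ Y) :
    IsInflation (conflationsOf D) f ↔ IsDeflation (conflationsOf (ext₂Image D)) f.op := by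
  constructor
  · rintro ⟨Z, g, w, M, p, h, hM⟩
    obtain ⟨hk, hp⟩ := isRes_map_iff.1 h
    have hc := isCoker_of_C₂ (hD M hM) hk hp
    obtain ⟨π, hπ⟩ := exists_isPresentation_extModule_two hk hp
    exact ⟨_, g.op, hc.op.zero, _, π, isRes_map_iff.2 ⟨hc.op, hπ⟩, M, hM, ⟨Iso.refl _⟩⟩
  · rintro ⟨Z, k, w, N, π, h, M, hM, ⟨e⟩⟩
    obtain ⟨hk, hπ⟩ := isRes_map_iff.1 h
    -- The opposite of a resolution `f₀, g₀` of `M` resolves `N`, as does `k, f.op`. The two are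
    -- homotopy equivalent, and the opposite equivalence shows that `f, k.unop` resolves `M`.
    obtain ⟨X₀, Y₀, Z₀, f₀, g₀, p₀, hk₀, hc₀, hp₀⟩ := (C₂_iff M).1 (hD M hM)
    obtain ⟨π₀, hπ₀⟩ := exists_isPresentation_extModule_two hk₀ hp₀
    replace hπ₀ := hπ₀.of_iso e.symm
    obtain ⟨φ, hφ⟩ := exists_complexHom hc₀.op.zero hπ₀ hk hπ
    obtain ⟨ψ, hψ⟩ := exists_complexHom hk.zero hπ hc₀.op hπ₀
    have h₁ := isHomotopyInverse_of_resolution hc₀.op hπ₀ φ hφ ψ hψ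
    have h₂ := isHomotopyInverse_of_resolution hk hπ ψ hψ φ hφ
    have hc := IsCoker.of_homotopy h₂ hk.zero hk₀.op
    exact ⟨_, k.unop, hc.unop.zero, M, _, isRes_map_iff.2 ⟨hc.unop,
      IsPresentation.of_homotopy (f := f₀) (f' := f) (φ := ψ.unop) (ψ := φ.unop)
        h₁.unop h₂.unop hp₀⟩, hM⟩

end Duality

/-! ### Exact structures and their defects -/

section ExactStructures

variable {C : Type u} [Category.{v} C] [Preadditive C] {F : ObjectProperty (ShortComplex C)}

lemma of_isKer [F.IsClosedUnderIsomorphisms] {X X' Y Z : C} {f : X ⟶ Y} {f' : X' ⟶ Y} {g : Y ⟶ Z}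
    (h : IsKer f g) (h' : IsKer f' g) (hF : F (ShortComplex.mk f' g h'.zero)) :
    F (ShortComplex.mk f g h.zero) := by
  have := h.mono
  have := h'.mono
  obtain ⟨a, ha⟩ := h.lift f' h'.zero
  obtain ⟨b, hb⟩ := h'.lift f h.zero
  refine F.prop_of_iso ?_ hF
  refine ShortComplex.isoMk ⟨a, b, ?_, ?_⟩ (Iso.refl _) (Iso.refl _) ?_ ?_
  · rw [← cancel_mono f', Category.assoc, hb, ha, Category.id_comp]
  · rw [← cancel_mono f, Category.assoc, ha, hb, Category.id_comp]
  · simpa using ha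
  · simp

lemma of_isCoker [F.IsClosedUnderIsomorphisms] {X Y Z Z' : C} {f : X ⟶ Y} {g : Y ⟶ Z} {g' : Y ⟶ Z'}
    (h : IsCoker f g) (h' : IsCoker f g') (hF : F (ShortComplex.mk f g' h'.zero)) :
    F (ShortComplex.mk f g h.zero) := by
  have := h.epi
  have := h'.epi
  obtain ⟨a, ha⟩ := h.desc g' h'.zero
  obtain ⟨b, hb⟩ := h'.desc g h.zero
  refine F.prop_of_iso ?_ hF
  refine ShortComplex.isoMk (Iso.refl _) (Iso.refl _) ⟨b, a, ?_, ?_⟩ ?_ ?_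
  · rw [← cancel_epi g', ← Category.assoc, hb, ha, Category.comp_id]
  · rw [← cancel_epi g, ← Category.assoc, ha, hb, Category.comp_id]
  · simp
  · simpa using hb.symm

lemma conflationsOf_isClosedUnderIsomorphisms (D : ObjectProperty (Modules C)) :
    (conflationsOf D).IsClosedUnderIsomorphisms where
  of_iso {S S'} e := by
    rintro ⟨M, p, h, hM⟩
    obtain ⟨hk, hp⟩ := isRes_map_iff.1 h
    have := hk.mono
    let φ : ComplexHom S.f S.g S'.f S'.g :=
      ⟨e.hom.τ₁, e.hom.τ₂, e.hom.τ₃, e.hom.comm₁₂, e.hom.comm₂₃⟩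
    let ψ : ComplexHom S'.f S'.g S.f S.g :=
      ⟨e.inv.τ₁, e.inv.τ₂, e.inv.τ₃, e.inv.comm₁₂, e.inv.comm₂₃⟩
    have h₁ : IsHomotopyInverse φ ψ := ⟨0, 0, by simp [φ, ψ, ← ShortComplex.comp_τ₃],
      by simp [φ, ψ, ← ShortComplex.comp_τ₂], by simp [φ, ψ, ← ShortComplex.comp_τ₁]⟩
    have h₂ : IsHomotopyInverse ψ φ := ⟨0, 0, by simp [φ, ψ, ← ShortComplex.comp_τ₃],
      by simp [φ, ψ, ← ShortComplex.comp_τ₂], by simp [φ, ψ, ← ShortComplex.comp_τ₁]⟩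
    refine ⟨M, _, isRes_map_iff.2 ⟨⟨?_, S'.zero, fun {T} x hx => ?_⟩, hp.of_homotopy h₁ h₂⟩, hM⟩
    · have : Mono (S'.f ≫ e.inv.τ₂) := by
        rw [← e.inv.comm₁₂]
        infer_instance
      exact mono_of_mono _ e.inv.τ₂
    · obtain ⟨y, hy⟩ := hk.lift (x ≫ e.inv.τ₂) (by
        rw [Category.assoc, e.inv.comm₂₃, reassoc_of% hx, zero_comp])
      refine ⟨y ≫ e.hom.τ₁, ?_⟩
      rw [Category.assoc, e.hom.comm₁₂, reassoc_of% hy, ← ShortComplex.comp_τ₂, e.inv_hom_id,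
        ShortComplex.id_τ₂, Category.comp_id]

lemma defects_iff {M : Modules C} : defects F M ↔
    ∃ (Y Z : C) (g : Y ⟶ Z) (p : (P C).obj Z ⟶ M), IsDeflation F g ∧ IsPresentation g p := by
  constructor
  · rintro ⟨S, hS, ⟨e⟩⟩
    exact ⟨_, _, S.g, _, ⟨_, S.f, S.zero, hS⟩, (isPresentation_cokernel S.g).of_iso e.symm⟩
  · rintro ⟨Y, Z, g, p, ⟨X, f, w, hF⟩, hp⟩
    exact ⟨_, hF, hp.unique (isPresentation_cokernel g)⟩

section

variable [HasZeroObject C] (hF : IsExactStructure F)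
include hF

lemma IsExactStructure.isDeflationClass :
    IsDeflationClass (C := C) (fun _ _ g => IsDeflation F g) where
  of_isIso {X Y} f _ := by
    have := hF.closedUnderIso
    refine ⟨(0 : C), 0, zero_comp, F.prop_of_iso ?_ (hF.ex₀ X)⟩
    exact ShortComplex.isoMk (Iso.refl _) (Iso.refl _) (asIso f)
  to_zero {X Y} f hY := by
    have := hF.closedUnderIso
    refine ⟨X, 𝟙 X, hY.eq_of_tgt _ _, F.prop_of_iso ?_ (hF.ex₀_op X)⟩
    exact ShortComplex.isoMk (Iso.refl _) (Iso.refl _) ((isZero_zero C).iso hY) (by simp)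
      (hY.eq_of_tgt _ _)
  comp := hF.ex₁
  pullback := hF.ex₂

/-- Inflations are the deflations of the opposite category, so the Serre argument applies to left
modules too. -/
lemma IsExactStructure.isDeflationClass_op :
    IsDeflationClass (C := Cᵒᵖ) (fun _ _ g => IsInflation F g.unop) where
  of_isIso {X Y} f _ := by
    have := hF.closedUnderIso
    refine ⟨(0 : C), 0, comp_zero, F.prop_of_iso ?_ (hF.ex₀_op X.unop)⟩
    exact ShortComplex.isoMk (asIso f.unop).symm (Iso.refl _) (Iso.refl _)
  to_zero {X Y} f hY := by
    have := hF.closedUnderIso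
    refine ⟨X.unop, 𝟙 X.unop, hY.unop.eq_of_src _ _, F.prop_of_iso ?_ (hF.ex₀ X.unop)⟩
    exact ShortComplex.isoMk ((isZero_zero C).iso hY.unop) (Iso.refl _) (Iso.refl _)
      ((isZero_zero C).eq_of_src _ _) (by simp)
  comp f g hf hg := hF.ex₁_op g.unop f.unop hg hf
  pullback {Y Z W} g h hg := by
    obtain ⟨A, l, k, sq, hk⟩ := hF.ex₂_op g.unop h.unop hg
    exact ⟨op A, l.op, k.op, sq.op.flip, hk⟩

lemma IsExactStructure.isKer {S : ShortComplex C} (hS : F S) : IsKer S.f S.g :=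
  ((isKernelCokernelPair_iff S).1 (hF.kernelCokernel S hS)).1

lemma IsExactStructure.isCoker {S : ShortComplex C} (hS : F S) : IsCoker S.f S.g :=
  ((isKernelCokernelPair_iff S).1 (hF.kernelCokernel S hS)).2

variable [EssentiallySmall.{v} C]

lemma IsExactStructure.defects_le_C₂ : defects F ≤ C₂ C := by
  intro M hM
  obtain ⟨Y, Z, g, p, ⟨X, f, w, hS⟩, hp⟩ := defects_iff.1 hM
  exact (C₂_iff M).2 ⟨X, Y, Z, f, g, p, hF.isKer hS, hF.isCoker hS, hp⟩

lemma IsExactStructure.ext₂Image_defects_iff (N : Modules Cᵒᵖ) : ext₂Image (defects F) N ↔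
    ∃ (Y Z : Cᵒᵖ) (g : Y ⟶ Z) (p : (P Cᵒᵖ).obj Z ⟶ N), IsInflation F g.unop ∧
      IsPresentation g p := by
  constructor
  · rintro ⟨M, hM, ⟨e⟩⟩
    obtain ⟨Y, Z, g, p, ⟨X, f, w, hS⟩, hp⟩ := defects_iff.1 hM
    obtain ⟨π, hπ⟩ := exists_isPresentation_extModule_two (hF.isKer hS) hp
    exact ⟨_, _, f.op, _, ⟨Z, g, w, hS⟩, hπ.of_iso e.symm⟩
  · rintro ⟨Y, Z, f, p, ⟨W, g, w, hS⟩, hp⟩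
    obtain ⟨π, hπ⟩ := exists_isPresentation_extModule_two (hF.isKer hS)
      (isPresentation_cokernel g)
    exact ⟨_, defects_iff.2 ⟨_, _, g, _, ⟨_, f.unop, w, hS⟩, isPresentation_cokernel g⟩,
      hp.unique hπ⟩

variable [HasBinaryBiproducts C]

lemma IsExactStructure.isTwoRegular_defects : IsTwoRegular (defects F) where
  le := hF.defects_le_C₂
  serre := hF.isDeflationClass.isSerreInFinGen fun _ => defects_iff
  serre_ext₂ := hF.isDeflationClass_op.isSerreInFinGen hF.ext₂Image_defects_iff

/-- For the hard inclusion, a deflation `k : A ⟶ S.X₃` factoring through `S.g` makes `(k S.g)` a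
deflation, and a shear turns it into `(0 S.g)`. Its kernel `1 ⊕ S.f` is an inflation, and pushing
out along the projection onto `S.X₁` recovers `S.f`. -/
lemma IsExactStructure.conflationsOf_defects : conflationsOf (defects F) = F := by
  have := hF.closedUnderIso
  ext S
  constructor
  · rintro ⟨M, p, hS, hM⟩
    obtain ⟨hk, hp⟩ := isRes_map_iff.1 hS
    have hc := isCoker_of_C₂ (hF.defects_le_C₂ M hM) hk hp
    have := hk.mono
    obtain ⟨Y', Z', g', p', hg', hp'⟩ := defects_iff.1 hM
    have := hp'.epi
    obtain ⟨z, hz⟩ := exists_map_lift p' p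
    obtain ⟨A, l, k, sq, hA⟩ := hF.ex₂ g' z hg'
    -- The deflation `k` is killed in `M` because `z` lifts `p` and `g'` is zero in `M`; hence it
    -- factors through `S.g`.
    obtain ⟨s, hs⟩ := hp.lift k (by
      rw [← hz, ← Category.assoc, ← (P C).map_comp, ← sq.w, (P C).map_comp, Category.assoc,
        hp'.zero, comp_zero])
    have hd : IsDeflation F (biprod.snd ≫ S.g : A ⊞ S.X₂ ⟶ S.X₃) := by
      let σ : A ⊞ S.X₂ ⟶ A ⊞ S.X₂ := biprod.lift biprod.fst (biprod.snd - biprod.fst ≫ s)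
      let σ' : A ⊞ S.X₂ ⟶ A ⊞ S.X₂ := biprod.lift biprod.fst (biprod.snd + biprod.fst ≫ s)
      have hσ : IsIso σ := ⟨σ', by ext <;> simp [σ, σ'], by ext <;> simp [σ, σ']⟩
      have e : biprod.snd ≫ S.g = σ ≫ biprod.desc k S.g := by
        rw [biprod.lift_desc, ← hs]
        simp
      rw [e]
      exact hF.ex₁ _ _ (hF.isDeflationClass.of_isIso σ hσ) (hF.isDeflationClass.desc hA S.g)
    obtain ⟨X', f', w', hS'⟩ := hd
    have hk' : IsKer (biprod.map (𝟙 A) S.f) (biprod.snd ≫ S.g) := by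
      refine ⟨Preadditive.mono_of_cancel_zero _ fun {T} x hx => ?_, by simp, fun {T} x hx => ?_⟩
      · refine biprod.hom_ext _ _ ?_ ?_
        · simpa using congrArg (· ≫ biprod.fst) hx
        · rw [← cancel_mono S.f]
          simpa using congrArg (· ≫ biprod.snd) hx
      · obtain ⟨y, hy⟩ := hk.lift (x ≫ biprod.snd) (by rw [Category.assoc, hx])
        exact ⟨biprod.lift (x ≫ biprod.fst) y, by ext <;> simp [hy]⟩
    have hF' := of_isKer hk' (hF.isKer hS') hS'
    have po : IsPushout (biprod.map (𝟙 A) S.f) biprod.snd biprod.snd S.f := by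
      refine ⟨⟨by simp⟩, ⟨PushoutCocone.IsColimit.mk _ (fun s => biprod.inr ≫ s.inl)
        (fun s => ?_) (fun s => ?_) (fun s m h₁ h₂ => ?_)⟩⟩
      · have := congrArg (biprod.inl ≫ ·) s.condition
        refine biprod.hom_ext' _ _ ?_ ?_
        · simpa using this.symm
        · simp
      · simpa using congrArg (biprod.inr ≫ ·) s.condition
      · simp [← h₁]
    -- Now `S.f` is an inflation with some cokernel `g''`. Since `M` lies in `C₂`, `S.g` is also a
    -- cokernel of `S.f`, so the two agree up to isomorphism.
    obtain ⟨Z'', g'', w'', hS''⟩ := hF.isDeflationClass_op.of_isPullback po.op.flip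
      ⟨_, _, _, hF'⟩
    have hc'' : IsCoker S.f g'' := hF.isCoker hS''
    exact of_isCoker hc hc'' hS''
  · intro hS
    exact ⟨_, cokernel.π _, isRes_map_iff.2 ⟨hF.isKer hS, isPresentation_cokernel S.g⟩,
      S, hS, ⟨Iso.refl _⟩⟩

end

end ExactStructures

/-! ### The exact structure of a subcategory `D` -/

section TwoRegular

variable {C : Type u} [Category.{v} C] [Preadditive C] [EssentiallySmall.{v} C]
  {D : ObjectProperty (Modules C)} (hD : IsTwoRegular D)
include hD

lemma IsTwoRegular.defects_conflationsOf : defects (conflationsOf D) = D := by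
  have := hD.serre.closedUnderIso
  ext M
  constructor
  · intro hM
    obtain ⟨Y, Z, g, p, ⟨X, f, w, N, q, h, hN⟩, hp⟩ := defects_iff.1 hM
    obtain ⟨e⟩ := (isRes_map_iff.1 h).2.unique hp
    exact D.prop_of_iso e hN
  · intro hM
    obtain ⟨X, Y, Z, f, g, p, hk, hc, hp⟩ := (C₂_iff M).1 (hD.le M hM)
    exact defects_iff.2 ⟨Y, Z, g, p, ⟨X, f, hk.zero, M, p, isRes_map_iff.2 ⟨hk, hp⟩, hM⟩, hp⟩

lemma IsTwoRegular.isExactStructure_conflationsOf [HasZeroObject C] [HasBinaryBiproducts C]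
    [IsIdempotentComplete C] : IsExactStructure (conflationsOf D) where
  kernelCokernel S := by
    rintro ⟨M, p, h, hM⟩
    obtain ⟨hk, hp⟩ := isRes_map_iff.1 h
    exact (isKernelCokernelPair_iff S).2 ⟨hk, isCoker_of_C₂ (hD.le M hM) hk hp⟩
  closedUnderIso := conflationsOf_isClosedUnderIsomorphisms D
  ex₀ X := by
    -- The split sequence `0 ⟶ X = X` resolves the zero module.
    obtain ⟨M, hM, hM'⟩ := hD.serre.zero
    exact ⟨M, 0, isRes_map_iff.2 ⟨⟨inferInstance, zero_comp,
      fun x hx => ⟨0, by simpa using hx.symm⟩⟩,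
      ⟨hM.epi _, comp_zero, fun x _ => ⟨x, Category.comp_id x⟩⟩⟩, hM'⟩
  ex₀_op X := by
    obtain ⟨M, hM, hM'⟩ := hD.serre.zero
    exact ⟨M, 0, isRes_map_iff.2 ⟨⟨inferInstance, comp_zero, fun x _ => ⟨x, Category.comp_id x⟩⟩,
      ⟨hM.epi _, comp_zero, fun x _ => ⟨0, (isZero_zero C).eq_of_tgt _ _⟩⟩⟩, hM'⟩
  ex₁ := isDeflation_comp (hasResolutions_of_le_C₂ hD.le) hD.serre
  ex₁_op f g hf hg := by
    rw [isInflation_conflationsOf_iff hD.le] at hf hg ⊢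
    exact isDeflation_comp (hasResolutions_ext₂Image hD.le) hD.serre_ext₂ _ _ hg hf
  ex₂ := isDeflation_pullback (hasResolutions_of_le_C₂ hD.le) hD.serre
  ex₂_op f h hf := by
    rw [isInflation_conflationsOf_iff hD.le] at hf
    obtain ⟨A, l, k, sq, hk⟩ :=
      isDeflation_pullback (hasResolutions_ext₂Image hD.le) hD.serre_ext₂ f.op h.op hf
    exact ⟨A.unop, l.unop, k.unop, sq.unop.flip, (isInflation_conflationsOf_iff hD.le _).2 hk⟩

end TwoRegular

end ExactStructures

theorem theorem2p7 {C : Type u} [Category.{v} C] [Preadditive C] [HasZeroObject C]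
    [HasBinaryBiproducts C] [EssentiallySmall.{v} C] [IsIdempotentComplete C] :
    (∀ F : ObjectProperty (ShortComplex C), ExactStructures.IsExactStructure F →
      ExactStructures.IsTwoRegular (ExactStructures.defects F)) ∧
    (∀ D : ObjectProperty (ExactStructures.Modules C), ExactStructures.IsTwoRegular D →
      ExactStructures.IsExactStructure (ExactStructures.conflationsOf D)) ∧
    (∀ F : ObjectProperty (ShortComplex C), ExactStructures.IsExactStructure F →
      ExactStructures.conflationsOf (ExactStructures.defects F) = F) ∧
    (∀ D : ObjectProperty (ExactStructures.Modules C), ExactStructures.IsTwoRegular D →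
      ExactStructures.defects (ExactStructures.conflationsOf D) = D) :=
  ⟨fun _ hF => hF.isTwoRegular_defects, fun _ hD => hD.isExactStructure_conflationsOf,
    fun _ hF => hF.conflationsOf_defects, fun _ hD => hD.defects_conflationsOf⟩
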